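/- Let $n\in\mathbb N$, $s\in(\tfrac32,2)$, and let $H^s=H^s(\mathbb R/\mathbb Z,\mathbb R^n)=W^{s,2}(\mathbb R/\mathbb Z,\mathbb R^n)$ be the Sobolev–Slobodeckij space of functions $f\in L^2$ that have a weak derivative $f'\in L^2$ with $[f']_{s-1}^2=\iint_{(\mathbb R/\mathbb Z)^2}\frac{|f'(x)-f'(y)|^2}{|x-y|_{\mathbb R/\mathbb Z}^{2s-1}}\,dx\,dy<\infty$, with the Hilbert norm $\|f\|_{H^s}^2=\|f\|_{L^2}^2+\|f'\|_{L^2}^2+[f']_{s-1}^2$. Functions in $H^s$ are identified with their $C^1$ representatives. Let $H^s_{\mathrm{i,r}}\subset H^s$ be the set of all $\gamma\in H^s$ that are injective and regular ($\gamma'(x)\ne0$ for all $x$). For $\gamma\in H^s_{\mathrm{i,r}}$ and $h,k\in H^s$ put $D_\gamma h=h'/|\gamma'|$, $$\mathcal R^s_\gamma h(x,y)=\frac{h(y)-h(x)-D_\gamma h(x)\,\langle D_\gamma\gamma(x),\gamma(y)-\gamma(x)\rangle}{|\gamma(y)-\gamma(x)|^s},\qquad d\mu_\gamma(x,y)=\frac{|\gamma'(x)|\,|\gamma'(y)|}{|\gamma(y)-\gamma(x)|}\,dx\,dy,$$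 and $$\begin{aligned}G_\gamma(h,k)={}&\int\langle h,k\rangle\,|\gamma'|\,dx+\int\langle D_\gamma h,D_\gamma k\rangle\,|\gamma'|\,dx+\iint\langle\mathcal R^s_\gamma h,\mathcal R^s_\gamma k\rangle\,d\mu_\gamma\\&+\iint|\mathcal R^s_\gamma\gamma|^2\,\frac{\langle h(y)-h(x),k(y)-k(x)\rangle}{|\gamma(y)-\gamma(x)|^2}\,d\mu_\gamma\\&+\iint|\mathcal R^s_\gamma\gamma|^2\bigl(\langle D_\gamma h(x),D_\gamma k(x)\rangle+\langle D_\gamma h(y),D_\gamma k(y)\rangle\bigr)\,d\mu_\gamma,\end{aligned}$$ where the single integrals are over $\mathbb R/\mathbb Z$ and the double integrals over $(\mathbb R/\mathbb Z)^2$. Then $H^s_{\mathrm{i,r}}$ is open in $H^s$; for all $\gamma\in H^s_{\mathrm{i,r}}$ and $h,k\in H^s$ all the integrals converge absolutely; $G_\gamma$ is a bounded, symmetric, positive definite bilinear form on $H^s$ for every $\gamma\in H^s_{\mathrm{i,r}}$; and the Riemannian metric $G$ is real analytic in $\gamma$: the map $\gamma\mapsto G_\gamma$ from $H^s_{\mathrm{i,r}}$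 into the Banach space of bounded bilinear forms on $H^s$ is real analytic, i.e. around every point of $H^s_{\mathrm{i,r}}$ it is given by a convergent power series of continuous multilinear maps. -/

import Mathlib

open MeasureTheory

noncomputable section

namespace KnotMetric

/-- The circle `ℝ/ℤ`. Its measure is Lebesgue measure of total mass one, and `‖x - y‖` is the
geodesic distance of `x` and `y`. -/
abbrev Circ : Type := UnitAddCircle

/-- The Euclidean space `ℝⁿ`. -/
abbrev E (n : ℕ) : Type := EuclideanSpace ℝ (Fin n)

/-- The classical derivative of a function on `ℝ/ℤ`. -/
def circDeriv {F : Type*} [NormedAddCommGroup F] [NormedSpace ℝ F] (f : Circ → F) (x : Circ) : F :=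
  deriv (fun t : ℝ => f (x + (t : Circ))) 0

/-- A test function on `ℝ/ℤ`: a real function whose one-periodic lift to `ℝ` is `C^∞`. -/
def IsTest (φ : Circ → ℝ) : Prop := ContDiff ℝ (⊤ : ℕ∞) (fun t : ℝ => φ (t : Circ))

/-- `g` is a weak derivative of `f` on `ℝ/ℤ`. -/
def HasWeakDeriv {n : ℕ} (f g : Circ → E n) : Prop :=
  ∀ φ : Circ → ℝ, IsTest φ → ∫ x, circDeriv φ x • f x = - ∫ x, φ x • g x

/-- The quotient `(g(x) - g(y)) / |x - y|^(1/2 + σ)`, whose `L²(ℝ/ℤ × ℝ/ℤ)` norm is the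
Sobolev-Slobodeckij (Gagliardo) seminorm `[g]_σ`. -/
def slobodeckijQuot {n : ℕ} (σ : ℝ) (g : Circ → E n) (p : Circ × Circ) : E n :=
  (‖p.1 - p.2‖ ^ (1 / 2 + σ))⁻¹ • (g p.1 - g p.2)

/-- `g` is a weak derivative of `f` in `W^{s-1,2}`. -/
structure IsSobolevDeriv {n : ℕ} (s : ℝ) (f g : Circ → E n) : Prop where
  weak : HasWeakDeriv f g
  memLp : MemLp g 2 volume
  quot_memLp : MemLp (slobodeckijQuot (s - 1) g) 2 volume

theorem memLp_of_continuous {n : ℕ} {f : Circ → E n} (hf : Continuous f) :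
    MemLp f 2 (volume : Measure Circ) := by
  exact hf.memLp_of_hasCompactSupport (HasCompactSupport.of_compactSpace f)

theorem IsTest.continuous {φ : Circ → ℝ} (h : IsTest φ) : Continuous φ := by
  have h1 : Continuous (fun t : ℝ => φ (t : Circ)) := ContDiff.continuous h
  exact continuous_coinduced_dom.2 h1

theorem circDeriv_coe {F : Type*} [NormedAddCommGroup F] [NormedSpace ℝ F] (f : Circ → F) (t : ℝ) :
    circDeriv f (t : Circ) = deriv (fun u : ℝ => f (u : Circ)) t := by
  unfold circDeriv
  have := deriv_comp_const_add (fun u : ℝ => f (u : Circ)) t 0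
  simpa using this

theorem IsTest.continuous_circDeriv {φ : Circ → ℝ} (h : IsTest φ) : Continuous (circDeriv φ) := by
  have h1 : Continuous (deriv (fun t : ℝ => φ (t : Circ))) :=
    ContDiff.continuous_deriv h (by exact_mod_cast le_top)
  have h2 : Continuous (fun t : ℝ => circDeriv φ (t : Circ)) := by
    simpa only [circDeriv_coe] using h1
  exact continuous_coinduced_dom.2 h2

theorem integrable_smul {n : ℕ} {φ : Circ → ℝ} (hφ : Continuous φ) {g : Circ → E n}
    (hg : MemLp g 2 (volume : Measure Circ)) : Integrable (fun x => φ x • g x) := by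
  obtain ⟨C, hC⟩ := isCompact_univ.exists_bound_of_continuousOn hφ.continuousOn
  have h1 : Integrable g := hg.integrable one_le_two
  have h2 : AEStronglyMeasurable φ (volume : Measure Circ) := hφ.aestronglyMeasurable
  have h3 : ∀ᵐ x : Circ, ‖φ x‖ ≤ C := ae_of_all _ fun x => hC x (Set.mem_univ x)
  have h4 : Integrable (φ • g) := h1.bdd_smul C h2 h3
  exact h4

theorem isTest_fourier_re (m : ℤ) : IsTest (fun x : Circ => (fourier m x).re) := by
  unfold IsTest
  simp only [fourier_coe_apply]
  refine Complex.reCLM.contDiff.comp ?_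
  have h1 : ContDiff ℝ (⊤ : ℕ∞) (fun t : ℝ => (t : ℂ)) := Complex.ofRealCLM.contDiff
  fun_prop

theorem isTest_fourier_im (m : ℤ) : IsTest (fun x : Circ => (fourier m x).im) := by
  unfold IsTest
  simp only [fourier_coe_apply]
  refine Complex.imCLM.contDiff.comp ?_
  have h1 : ContDiff ℝ (⊤ : ℕ∞) (fun t : ℝ => (t : ℂ)) := Complex.ofRealCLM.contDiff
  fun_prop

theorem ae_eq_zero_of_test {n : ℕ} {g : Circ → E n} (hg : MemLp g 2 (volume : Measure Circ))
    (h : ∀ φ : Circ → ℝ, IsTest φ → ∫ x, φ x • g x = 0) : g =ᵐ[volume] 0 := by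
  have key : ∀ i : Fin n, (fun x => g x i) =ᵐ[volume] 0 := by
    intro i
    have hgi : MemLp (fun x => g x i) 2 (volume : Measure Circ) :=
      ContinuousLinearMap.comp_memLp' (EuclideanSpace.proj (𝕜 := ℝ) i) hg
    have hG : MemLp (fun x => ((g x i : ℝ) : ℂ)) 2 (volume : Measure Circ) := hgi.ofReal
    have hG' : MemLp (fun x => ((g x i : ℝ) : ℂ)) 2 (AddCircle.haarAddCircle (T := 1)) :=
      memLp_haarAddCircle_iff.2 hG
    have htest : ∀ φ : Circ → ℝ, IsTest φ → ∫ x, φ x * g x i = 0 := by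
      intro φ hφ
      have h1 := ContinuousLinearMap.integral_comp_comm (EuclideanSpace.proj (𝕜 := ℝ) i)
        (integrable_smul hφ.continuous hg)
      rw [h φ hφ] at h1
      simpa using h1
    have hint : ∀ φ : Circ → ℝ, IsTest φ → Integrable (fun x => φ x * g x i) := by
      intro φ hφ
      have h1 := ContinuousLinearMap.integrable_comp (EuclideanSpace.proj (𝕜 := ℝ) i)
        (integrable_smul hφ.continuous hg)
      simpa using h1
    have hcoef : ∀ m : ℤ, fourierCoeff (T := 1) (fun x => ((g x i : ℝ) : ℂ)) m = 0 := by
      intro m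
      unfold fourierCoeff
      rw [AddCircle.integral_haarAddCircle]
      have hsplit : ∀ x : Circ, fourier (-m) x • ((g x i : ℝ) : ℂ) =
          (((fourier (-m) x).re * g x i : ℝ) : ℂ) +
            (((fourier (-m) x).im * g x i : ℝ) : ℂ) * Complex.I := by
        intro x
        apply Complex.ext <;> simp
      simp_rw [hsplit]
      have hr := isTest_fourier_re (-m)
      have hi := isTest_fourier_im (-m)
      rw [integral_add (hint _ hr).ofReal ((hint _ hi).ofReal.mul_const _), integral_mul_const]
      have e1 : ∫ x : Circ, (((fourier (-m) x).re * g x i : ℝ) : ℂ) = 0 := by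
        rw [integral_complex_ofReal, htest _ hr, Complex.ofReal_zero]
      have e2 : ∫ x : Circ, (((fourier (-m) x).im * g x i : ℝ) : ℂ) = 0 := by
        rw [integral_complex_ofReal, htest _ hi, Complex.ofReal_zero]
      erw [e1, e2]
      simp
    have hz : hG'.toLp _ = 0 := by
      apply (fourierBasis (T := 1)).repr.injective
      ext m
      rw [fourierBasis_repr, map_zero, fourierCoeff_congr_ae hG'.coeFn_toLp, hcoef m]
      rfl
    have h0 := hG'.coeFn_toLp
    rw [hz] at h0
    have h1 : (fun x => ((g x i : ℝ) : ℂ)) =ᵐ[AddCircle.haarAddCircle (T := 1)] 0 :=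
      h0.symm.trans (Lp.coeFn_zero _ _ _)
    have h2 : (fun x => ((g x i : ℝ) : ℂ)) =ᵐ[(volume : Measure Circ)] 0 := by
      rw [AddCircle.volume_eq_smul_haarAddCircle]
      exact Measure.ae_smul_measure h1 _
    filter_upwards [h2] with x hx
    simpa using hx
  filter_upwards [ae_all_iff.2 key] with x hx
  ext i
  simpa using hx i

theorem HasWeakDeriv.ae_eq {n : ℕ} {f g₁ g₂ : Circ → E n} (h₁ : HasWeakDeriv f g₁)
    (h₂ : HasWeakDeriv f g₂) (m₁ : MemLp g₁ 2 (volume : Measure Circ))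
    (m₂ : MemLp g₂ 2 (volume : Measure Circ)) : g₁ =ᵐ[volume] g₂ := by
  have h : g₁ - g₂ =ᵐ[volume] 0 := by
    apply ae_eq_zero_of_test (m₁.sub m₂)
    intro φ hφ
    have e₁ := h₁ φ hφ
    have e₂ := h₂ φ hφ
    simp only [Pi.sub_apply, smul_sub]
    rw [integral_sub (integrable_smul hφ.continuous m₁) (integrable_smul hφ.continuous m₂)]
    rw [e₁, neg_inj] at e₂
    rw [e₂, sub_self]
  filter_upwards [h] with x hx
  simpa [sub_eq_zero] using hx

theorem IsSobolevDeriv.add {n : ℕ} {s : ℝ} {f₁ f₂ g₁ g₂ : Circ → E n} (c₁ : Continuous f₁)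
    (c₂ : Continuous f₂) (h₁ : IsSobolevDeriv s f₁ g₁) (h₂ : IsSobolevDeriv s f₂ g₂) :
    IsSobolevDeriv s (f₁ + f₂) (g₁ + g₂) where
  weak := by
    intro φ hφ
    simp only [Pi.add_apply, smul_add]
    rw [integral_add (integrable_smul hφ.continuous h₁.memLp)
        (integrable_smul hφ.continuous h₂.memLp),
      integral_add (integrable_smul hφ.continuous_circDeriv (memLp_of_continuous c₁))
        (integrable_smul hφ.continuous_circDeriv (memLp_of_continuous c₂)),
      h₁.weak φ hφ, h₂.weak φ hφ, neg_add]
  memLp := h₁.memLp.add h₂.memLp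
  quot_memLp := by
    have h := h₁.quot_memLp.add h₂.quot_memLp
    convert h using 1
    ext1 p
    simp only [slobodeckijQuot, Pi.add_apply, ← smul_add]
    congr 1
    abel

theorem IsSobolevDeriv.smul {n : ℕ} {s : ℝ} {f g : Circ → E n} (c : ℝ)
    (h : IsSobolevDeriv s f g) : IsSobolevDeriv s (c • f) (c • g) where
  weak := by
    intro φ hφ
    simp only [Pi.smul_apply, smul_comm _ c]
    rw [integral_smul, integral_smul, h.weak φ hφ, smul_neg]
  memLp := h.memLp.const_smul c
  quot_memLp := by
    have e : slobodeckijQuot (s - 1) (c • g) = c • slobodeckijQuot (s - 1) g := by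
      ext1 p
      simp only [slobodeckijQuot, Pi.smul_apply, ← smul_sub]
      exact smul_comm _ _ _
    rw [e]
    exact h.quot_memLp.const_smul c

theorem IsSobolevDeriv.zero {n : ℕ} {s : ℝ} :
    IsSobolevDeriv s (0 : Circ → E n) (0 : Circ → E n) where
  weak := by intro φ _; simp
  memLp := MemLp.zero
  quot_memLp := by
    have h : slobodeckijQuot (s - 1) (0 : Circ → E n) = 0 := by
      ext1 p; simp [slobodeckijQuot]
    rw [h]; exact MemLp.zero

/-- The functions in `H^s(ℝ/ℤ, ℝⁿ) = W^{s,2}(ℝ/ℤ, ℝⁿ)`, `1 < s < 2`, each given by its continuous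
representative: `f` has a weak derivative in `L²` whose Gagliardo seminorm of order `s - 1` is
finite. -/
def sobolevSubmodule (s : ℝ) (n : ℕ) : Submodule ℝ (Circ → E n) where
  carrier := {f | Continuous f ∧ ∃ g, IsSobolevDeriv s f g}
  add_mem' := by
    rintro f₁ f₂ ⟨c₁, g₁, h₁⟩ ⟨c₂, g₂, h₂⟩
    exact ⟨c₁.add c₂, _, h₁.add c₁ c₂ h₂⟩
  zero_mem' := ⟨continuous_const, 0, IsSobolevDeriv.zero⟩
  smul_mem' := by
    rintro c f ⟨c₁, g, h⟩
    exact ⟨c₁.const_smul c, _, h.smul c⟩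

/-- The Sobolev-Slobodeckij space `H^s(ℝ/ℤ, ℝⁿ)`, `1 < s < 2`. It carries the inner product
`⟨f, g⟩_{L²} + ⟨f', g'⟩_{L²} + ∬ ⟨f'(x) - f'(y), g'(x) - g'(y)⟩ / |x - y|^(2s - 1)`. -/
def Hs (s : ℝ) (n : ℕ) : Type := ↥(sobolevSubmodule s n)

namespace Hs

variable {s : ℝ} {n : ℕ}

instance : AddCommGroup (Hs s n) := inferInstanceAs (AddCommGroup ↥(sobolevSubmodule s n))

instance : Module ℝ (Hs s n) := inferInstanceAs (Module ℝ ↥(sobolevSubmodule s n))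

/-- The (continuous) function underlying an element of `H^s`. -/
def toFun (f : Hs s n) : Circ → E n := Subtype.val f

instance : CoeFun (Hs s n) (fun _ => Circ → E n) := ⟨toFun⟩

theorem continuous (f : Hs s n) : Continuous f.toFun := (Subtype.property f).1

theorem toFun_add (f g : Hs s n) : (f + g).toFun = f.toFun + g.toFun := rfl

theorem toFun_smul (c : ℝ) (f : Hs s n) : (c • f).toFun = c • f.toFun := rfl

theorem toFun_injective : Function.Injective (toFun : Hs s n → Circ → E n) :=
  Subtype.val_injective

/-- The weak derivative of an element of `H^s`, determined almost everywhere. -/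
def weakDeriv (f : Hs s n) : Circ → E n := (Subtype.property f).2.choose

theorem isSobolevDeriv (f : Hs s n) : IsSobolevDeriv s f.toFun f.weakDeriv :=
  (Subtype.property f).2.choose_spec

theorem weakDeriv_add (f g : Hs s n) :
    (f + g).weakDeriv =ᵐ[volume] f.weakDeriv + g.weakDeriv :=
  have h := f.isSobolevDeriv.add f.continuous g.continuous g.isSobolevDeriv
  (f + g).isSobolevDeriv.weak.ae_eq h.weak (f + g).isSobolevDeriv.memLp h.memLp

theorem weakDeriv_smul (c : ℝ) (f : Hs s n) :
    (c • f).weakDeriv =ᵐ[volume] c • f.weakDeriv :=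
  have h := f.isSobolevDeriv.smul c
  (c • f).isSobolevDeriv.weak.ae_eq h.weak (c • f).isSobolevDeriv.memLp h.memLp

theorem quot_congr {σ : ℝ} {g₁ g₂ : Circ → E n} (h : g₁ =ᵐ[volume] g₂) :
    slobodeckijQuot σ g₁ =ᵐ[volume] slobodeckijQuot σ g₂ := by
  have h1 : ∀ᵐ p : Circ × Circ, g₁ p.1 = g₂ p.1 :=
    Measure.quasiMeasurePreserving_fst.ae h
  have h2 : ∀ᵐ p : Circ × Circ, g₁ p.2 = g₂ p.2 :=
    Measure.quasiMeasurePreserving_snd.ae h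
  filter_upwards [h1, h2] with p e1 e2
  simp only [slobodeckijQuot, e1, e2]

/-- The class of `f` in `L²(ℝ/ℤ)`. -/
def toL2 : Hs s n →ₗ[ℝ] Lp (E n) 2 (volume : Measure Circ) where
  toFun f := (memLp_of_continuous f.continuous).toLp f.toFun
  map_add' f g := MemLp.toLp_add (memLp_of_continuous f.continuous)
    (memLp_of_continuous g.continuous)
  map_smul' c f := MemLp.toLp_const_smul c (memLp_of_continuous f.continuous)

/-- The class of the weak derivative of `f` in `L²(ℝ/ℤ)`. -/
def derivL2 : Hs s n →ₗ[ℝ] Lp (E n) 2 (volume : Measure Circ) where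
  toFun f := f.isSobolevDeriv.memLp.toLp f.weakDeriv
  map_add' f g := by
    rw [← MemLp.toLp_add f.isSobolevDeriv.memLp g.isSobolevDeriv.memLp]
    exact MemLp.toLp_congr _ _ (weakDeriv_add f g)
  map_smul' c f := by
    rw [RingHom.id_apply, ← MemLp.toLp_const_smul c f.isSobolevDeriv.memLp]
    exact MemLp.toLp_congr _ _ (weakDeriv_smul c f)

/-- The class of `(f'(x) - f'(y)) / |x - y|^(s - 1/2)` in `L²(ℝ/ℤ × ℝ/ℤ)`. -/
def quotL2 : Hs s n →ₗ[ℝ] Lp (E n) 2 (volume : Measure (Circ × Circ)) where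
  toFun f := f.isSobolevDeriv.quot_memLp.toLp (slobodeckijQuot (s - 1) f.weakDeriv)
  map_add' f g := by
    rw [← MemLp.toLp_add f.isSobolevDeriv.quot_memLp g.isSobolevDeriv.quot_memLp]
    refine MemLp.toLp_congr _ _ ((quot_congr (weakDeriv_add f g)).trans (ae_of_all _ fun p => ?_))
    simp only [slobodeckijQuot, Pi.add_apply, ← smul_add]
    congr 1
    abel
  map_smul' c f := by
    rw [RingHom.id_apply, ← MemLp.toLp_const_smul c f.isSobolevDeriv.quot_memLp]
    refine MemLp.toLp_congr _ _ ((quot_congr (weakDeriv_smul c f)).trans (ae_of_all _ fun p => ?_))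
    simp only [slobodeckijQuot, Pi.smul_apply, ← smul_sub]
    exact smul_comm _ _ _

theorem toL2_injective : Function.Injective (toL2 : Hs s n →ₗ[ℝ] _) := by
  intro f g h
  apply toFun_injective
  have h1 : f.toFun =ᵐ[volume] g.toFun :=
    (MemLp.toLp_eq_toLp_iff (memLp_of_continuous f.continuous)
      (memLp_of_continuous g.continuous)).1 h
  exact Continuous.ae_eq_iff_eq volume f.continuous g.continuous |>.1 h1

/-- The isometric embedding `f ↦ (f, f', (f'(x) - f'(y)) / |x - y|^(s - 1/2))` of `H^s` into the
Hilbert sum `L² ⊕ L² ⊕ L²` that defines the norm of `H^s`. -/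
def graph : Hs s n →ₗ[ℝ] WithLp 2 (Lp (E n) 2 (volume : Measure Circ) ×
    WithLp 2 (Lp (E n) 2 (volume : Measure Circ) × Lp (E n) 2 (volume : Measure (Circ × Circ)))) :=
  (WithLp.linearEquiv 2 ℝ _).symm.toLinearMap ∘ₗ
    toL2.prod ((WithLp.linearEquiv 2 ℝ _).symm.toLinearMap ∘ₗ derivL2.prod quotL2)

theorem graph_injective : Function.Injective (graph : Hs s n →ₗ[ℝ] _) := by
  intro f g h
  exact toL2_injective (congrArg (fun u => u.fst) h)

instance : NormedAddCommGroup (Hs s n) := NormedAddCommGroup.induced (Hs s n) _ graph graph_injective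

instance : NormedSpace ℝ (Hs s n) := NormedSpace.induced ℝ (Hs s n) _ graph

instance : InnerProductSpace ℝ (Hs s n) where
  inner f g := inner ℝ (graph f) (graph g)
  norm_sq_eq_re_inner f := norm_sq_eq_re_inner (𝕜 := ℝ) (graph f)
  conj_inner_symm f g := inner_conj_symm (𝕜 := ℝ) (graph f) (graph g)
  add_left f g h := by rw [map_add, inner_add_left]
  smul_left f g c := by rw [map_smul, inner_smul_left]

/-- The inner product of `H^s`, written out. -/
theorem inner_eq (f g : Hs s n) : inner ℝ f g =
    (∫ x, inner ℝ (f x) (g x)) + (∫ x, inner ℝ (f.weakDeriv x) (g.weakDeriv x)) +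
      ∫ p, inner ℝ (slobodeckijQuot (s - 1) f.weakDeriv p)
        (slobodeckijQuot (s - 1) g.weakDeriv p) := by
  have h : inner ℝ f g = inner ℝ (toL2 f) (toL2 g) +
      (inner ℝ (derivL2 f) (derivL2 g) + inner ℝ (quotL2 f) (quotL2 g)) := rfl
  rw [h, ← add_assoc, L2.inner_def, L2.inner_def, L2.inner_def]
  congr 1
  · congr 1
    · refine integral_congr_ae ?_
      filter_upwards [MemLp.coeFn_toLp (memLp_of_continuous f.continuous),
        MemLp.coeFn_toLp (memLp_of_continuous g.continuous)] with x h1 h2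
      exact congrArg₂ (inner ℝ) h1 h2
    · refine integral_congr_ae ?_
      filter_upwards [MemLp.coeFn_toLp f.isSobolevDeriv.memLp,
        MemLp.coeFn_toLp g.isSobolevDeriv.memLp] with x h1 h2
      exact congrArg₂ (inner ℝ) h1 h2
  · refine integral_congr_ae ?_
    filter_upwards [MemLp.coeFn_toLp f.isSobolevDeriv.quot_memLp,
      MemLp.coeFn_toLp g.isSobolevDeriv.quot_memLp] with x h1 h2
    exact congrArg₂ (inner ℝ) h1 h2

end Hs

/-- The set `H^s_{i,r}` of injective regular curves in `H^s(ℝ/ℤ, ℝⁿ)`, `s > 3/2`. Curves in `H^s`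
are continuously differentiable, and regular means that `γ'` vanishes nowhere. -/
def embeddings (s : ℝ) (n : ℕ) : Set (Hs s n) :=
  {γ | Function.Injective γ.toFun ∧ ∀ x, circDeriv γ.toFun x ≠ 0}

variable {n : ℕ}

/-- Differentiation with respect to arclength, `D_γ h = h' / |γ'|`. -/
def arcDeriv (γ h : Circ → E n) (x : Circ) : E n :=
  ‖circDeriv γ x‖⁻¹ • circDeriv h x

/-- The operator `R^s_γ h (x, y) =
|γ(y) - γ(x)|^(-s) (h(y) - h(x) - D_γ h(x) ⟨D_γ γ(x), γ(y) - γ(x)⟩)`. -/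
def op (s : ℝ) (γ h : Circ → E n) (p : Circ × Circ) : E n :=
  (‖γ p.2 - γ p.1‖ ^ s)⁻¹ •
    (h p.2 - h p.1 - inner ℝ (arcDeriv γ γ p.1) (γ p.2 - γ p.1) • arcDeriv γ h p.1)

/-- The density `|γ'(x)| |γ'(y)| / |γ(y) - γ(x)|` of the measure `μ_γ`. -/
def weight (γ : Circ → E n) (p : Circ × Circ) : ℝ :=
  ‖circDeriv γ p.1‖ * ‖circDeriv γ p.2‖ / ‖γ p.2 - γ p.1‖

/-- The integrand of `⟨h, k⟩_{L²(|γ'| dx)}`. -/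
def l2Integrand (γ h k : Circ → E n) (x : Circ) : ℝ :=
  inner ℝ (h x) (k x) * ‖circDeriv γ x‖

/-- The integrand of `⟨D_γ h, D_γ k⟩_{L²(|γ'| dx)}`. -/
def h1Integrand (γ h k : Circ → E n) (x : Circ) : ℝ :=
  inner ℝ (arcDeriv γ h x) (arcDeriv γ k x) * ‖circDeriv γ x‖

/-- The integrand of `B¹_γ(h, k)`. -/
def b1Integrand (s : ℝ) (γ h k : Circ → E n) (p : Circ × Circ) : ℝ :=
  inner ℝ (op s γ h p) (op s γ k p) * weight γ p

/-- The integrand of `B²_γ(h, k)`. -/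
def b2Integrand (s : ℝ) (γ h k : Circ → E n) (p : Circ × Circ) : ℝ :=
  ‖op s γ γ p‖ ^ 2 * (inner ℝ (h p.2 - h p.1) (k p.2 - k p.1) / ‖γ p.2 - γ p.1‖ ^ 2) * weight γ p

/-- The integrand of `B³_γ(h, k)`. -/
def b3Integrand (s : ℝ) (γ h k : Circ → E n) (p : Circ × Circ) : ℝ :=
  ‖op s γ γ p‖ ^ 2 *
    (inner ℝ (arcDeriv γ h p.1) (arcDeriv γ k p.1) +
      inner ℝ (arcDeriv γ h p.2) (arcDeriv γ k p.2)) * weight γ p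

/-- All the integrals in the definition of `G_γ(h, k)` converge absolutely. -/
def MetricIntegrable (s : ℝ) (γ h k : Circ → E n) : Prop :=
  Integrable (l2Integrand γ h k) ∧ Integrable (h1Integrand γ h k) ∧
    Integrable (b1Integrand s γ h k) ∧ Integrable (b2Integrand s γ h k) ∧
    Integrable (b3Integrand s γ h k)

/-- The metric `G_γ(h, k)`. -/
def metric (s : ℝ) (γ h k : Circ → E n) : ℝ :=
  (∫ x, l2Integrand γ h k x) + (∫ x, h1Integrand γ h k x) +
    (∫ p, b1Integrand s γ h k p) + (∫ p, b2Integrand s γ h k p) + (∫ p, b3Integrand s γ h k p)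

end KnotMetric

end

/-!
The idea is to write `G_γ` as a composition of maps that are visibly analytic in `γ`: bounded linear
operators, bounded multilinear maps given by Hölder's inequality, and real powers of uniformly
positive bounded continuous functions.

*Sobolev embedding.* A function `f ∈ H^s`, `s > 3/2`, is `C¹` with `sup |f'|` bounded by the norm
(`exists_hasDerivAt_of_hasWeakDeriv`). The difference quotients of `f` with steps `2⁻ᵏ` form a
uniform Cauchy sequence, because second differences of `f` are differences of averages of the weak
derivative over neighbouring arcs (`norm_second_difference_le`). Hence `H^s` is controlled in `C¹`.
By compactness a curve is embedded exactly when `|γ(y) - γ(x)| ≥ c |y - x|` and `|γ'| ≥ c` for some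
`c > 0`, which is an open condition (`exists_lower_bound`, `isOpen_embeddings`).

*The singular terms.* Write `h(y) - h(x) = (y - x) h'(x) + S h(x, y)`. The linear parts cancel in
`R^s_γ h`, which leaves
`S h - |γ'(x)|⁻² ⟨γ'(x), S γ⟩ h'(x)`, divided by `|γ(y) - γ(x)|^s` (`op_eq_smul_normalQuot`).
The quotient `S h / |y - x|^(s + 1/2)` is bounded in `L²` by the Gagliardo seminorm of `h'`
(`eLpNorm_taylorQuot_le`), so that `h ↦ S h / |y - x|^(s + 1/2)` is a fixed bounded operator
from `H^s` to `L²`. All that remains of the weights are powers of the functions `|γ'(x)|²`,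
`|γ'(y)|²` and `q = |γ(y) - γ(x)|² / |y - x|²`, which are quadratic in `γ` and bounded below
(`opFactor_sq_mul_weight`).

*Analyticity.* On the Banach algebra of bounded continuous functions on the pairs `x ≠ y`, the map
`g ↦ g ^ a` is analytic near every function with a positive lower bound, by the binomial series
(`analyticAt_bcfRpow`). Omitting the diagonal, which is a null set, makes `q` continuous.
The form `metricForm` is assembled from these pieces; `analyticAt_metricForm` gives its analyticity
and `metricIntegrable_and_metricForm_eq` identifies it with the integrals that define `G_γ`.
-/

noncomputable section

namespace KnotMetric

open Set Filter Topology
open scoped BoundedContinuousFunction ENNReal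

variable {n : ℕ} {s : ℝ}

/-! ### Weak derivatives and increments -/

instance : IsProbabilityMeasure (volume : Measure Circ) := ⟨UnitAddCircle.measure_univ⟩

theorem isTest_comp_sub {φ : Circ → ℝ} (h : IsTest φ) (τ : ℝ) :
    IsTest (fun x => φ (x - (τ : Circ))) := by
  unfold IsTest at *
  have h1 : ContDiff ℝ (⊤ : ℕ∞) (fun t : ℝ => t - τ) := by fun_prop
  simpa [Function.comp_def] using h.comp h1

theorem circDeriv_comp_sub {F : Type*} [NormedAddCommGroup F] [NormedSpace ℝ F] (φ : Circ → F)
    (a x : Circ) : circDeriv (fun x => φ (x - a)) x = circDeriv φ (x - a) := by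
  unfold circDeriv
  simp only [add_sub_right_comm]

/-- The derivative on the circle of a function whose lift is differentiable. -/
theorem hasDerivAt_add_coe {F : Type*} [NormedAddCommGroup F] [NormedSpace ℝ F] {f g : Circ → F}
    (h : ∀ t : ℝ, HasDerivAt (fun u : ℝ => f (u : Circ)) (g (t : Circ)) t) (x : Circ) (t : ℝ) :
    HasDerivAt (fun u : ℝ => f (x + (u : Circ))) (g (x + (t : Circ))) t := by
  obtain ⟨y, rfl⟩ := QuotientAddGroup.mk_surjective x
  have h1 := (h (y + t)).comp_const_add y t
  simpa using h1

theorem circDeriv_eq_of_hasDerivAt {F : Type*} [NormedAddCommGroup F] [NormedSpace ℝ F]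
    {f g : Circ → F} (h : ∀ t : ℝ, HasDerivAt (fun u : ℝ => f (u : Circ)) (g (t : Circ)) t) :
    circDeriv f = g := by
  ext1 x
  have := (hasDerivAt_add_coe h x 0).deriv
  simpa [circDeriv] using this

theorem IsTest.hasDerivAt {φ : Circ → ℝ} (h : IsTest φ) (t : ℝ) :
    HasDerivAt (fun u : ℝ => φ (u : Circ)) (circDeriv φ (t : Circ)) t := by
  rw [circDeriv_coe]
  exact (ContDiff.differentiable h (by simp)).differentiableAt.hasDerivAt

theorem coe_continuous : Continuous (fun t : ℝ => (t : Circ)) := AddCircle.continuous_mk' 1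

/-- The fundamental theorem of calculus along an arc of the circle. -/
theorem integral_circDeriv_eq {F : Type*} [NormedAddCommGroup F] [NormedSpace ℝ F]
    [CompleteSpace F] {f g : Circ → F}
    (h : ∀ t : ℝ, HasDerivAt (fun u : ℝ => f (u : Circ)) (g (t : Circ)) t) (hg : Continuous g)
    (x : Circ) (a b : ℝ) :
    ∫ t in a..b, g (x + (t : Circ)) = f (x + (b : Circ)) - f (x + (a : Circ)) := by
  apply intervalIntegral.integral_eq_sub_of_hasDerivAt
  · intro t _
    exact hasDerivAt_add_coe h x t
  · apply Continuous.intervalIntegrable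
    exact hg.comp (continuous_const.add coe_continuous)

theorem measurePreserving_id_prod_coe :
    MeasurePreserving (fun p : Circ × ℝ => (p.1, (p.2 : Circ)))
      ((volume : Measure Circ).prod (volume.restrict (Ioc (0 : ℝ) 1))) volume := by
  have h := (UnitAddCircle.measurePreserving_mk 0)
  rw [zero_add] at h
  exact (MeasurePreserving.id (volume : Measure Circ)).prod h

/-- Integrability over the torus gives integrability over arcs of length at most one in the second
variable. -/
theorem integrable_prod_arc {F : Type*} [NormedAddCommGroup F] {H : Circ × Circ → F}
    (hH : Integrable H) {τ : ℝ} (hτ1 : τ ≤ 1) :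
    Integrable (fun p : Circ × ℝ => H (p.1, (p.2 : Circ)))
      ((volume : Measure Circ).prod (volume.restrict (Ioc (0 : ℝ) τ))) := by
  have h1 := measurePreserving_id_prod_coe.integrable_comp_of_integrable hH
  exact h1.mono_measure
    (Measure.prod_mono le_rfl (Measure.restrict_mono (Ioc_subset_Ioc_right hτ1) le_rfl))

theorem integrable_comp_add_prod {F : Type*} [NormedAddCommGroup F] {g : Circ → F}
    (hg : Integrable g) : Integrable (fun p : Circ × Circ => g (p.1 + p.2)) := by
  have h1 : Integrable (fun p : Circ × Circ => g p.1) := hg.comp_fst _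
  exact (measurePreserving_add_prod volume volume).integrable_comp_of_integrable h1

/-- A weak derivative integrates to the increments of the function. The test function is moved
along the arc, so that only Fubini's theorem is used. -/
theorem HasWeakDeriv.sub_ae_eq {f g : Circ → E n} (hw : HasWeakDeriv f g) (hf : Continuous f)
    (hg : MemLp g 2 (volume : Measure Circ)) {τ : ℝ} (h0 : 0 ≤ τ) (h1 : τ ≤ 1) :
    ∀ᵐ x : Circ, f (x + (τ : Circ)) - f x = ∫ t in (0 : ℝ)..τ, g (x + (t : Circ)) := by
  have hgi : Integrable g := hg.integrable one_le_two
  have hprod := integrable_prod_arc (integrable_comp_add_prod hgi) h1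
  have hI1 : AEStronglyMeasurable (fun x : Circ => ∫ t in (0 : ℝ)..τ, g (x + (t : Circ))) := by
    simp only [intervalIntegral.integral_of_le h0]
    exact hprod.1.integral_prod_right'
  have harc : ∀ x : Circ, Integrable (fun t : ℝ => g (x + (t : Circ)))
      (volume.restrict (Ioc (0 : ℝ) 1)) := by
    intro x
    have e : Integrable (fun y : Circ => g (x + y)) := hgi.comp_add_left x
    have := UnitAddCircle.measurePreserving_mk 0
    rw [zero_add] at this
    exact this.integrable_comp_of_integrable e
  have hI2 : ∀ x : Circ, ‖∫ t in (0 : ℝ)..τ, g (x + (t : Circ))‖ ≤ ∫ y, ‖g y‖ := by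
    intro x
    calc ‖∫ t in (0 : ℝ)..τ, g (x + (t : Circ))‖
        ≤ ∫ t in (0 : ℝ)..τ, ‖g (x + (t : Circ))‖ :=
          intervalIntegral.norm_integral_le_integral_norm h0
      _ ≤ ∫ t in (0 : ℝ)..1, ‖g (x + (t : Circ))‖ := by
          rw [intervalIntegral.integral_of_le h0, intervalIntegral.integral_of_le zero_le_one]
          refine setIntegral_mono_set (harc x).norm (ae_of_all _ fun t => norm_nonneg _) ?_
          exact (Ioc_subset_Ioc_right h1).eventuallyLE
      _ = ∫ y, ‖g y‖ := by
          have e := UnitAddCircle.intervalIntegral_preimage 0 (fun y => ‖g (x + y)‖)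
          rw [zero_add] at e
          rw [e]
          exact integral_add_left_eq_self (fun y => ‖g y‖) x
  -- the difference of both sides is square integrable and orthogonal to all test functions
  have hIm : MemLp (fun x : Circ => ∫ t in (0 : ℝ)..τ, g (x + (t : Circ))) 2 volume :=
    MemLp.of_bound hI1 _ (ae_of_all _ hI2)
  have hfs : Continuous (fun x : Circ => f (x + (τ : Circ)) - f x) := by fun_prop
  have key := ae_eq_zero_of_test ((memLp_of_continuous hfs).sub hIm) ?_
  · filter_upwards [key] with x hx
    simpa [sub_eq_zero] using hx
  intro φ hφ
  have hφc := hφ.continuous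
  have hφ' := hφ.continuous_circDeriv
  simp only [Pi.sub_apply, smul_sub]
  rw [integral_sub (by
      have : Continuous (fun x => φ x • f (x + (τ : Circ)) - φ x • f x) := by fun_prop
      exact this.integrable_of_hasCompactSupport (HasCompactSupport.of_compactSpace _))
      (integrable_smul hφc hIm), sub_eq_zero]
  have hF : Integrable (fun p : Circ × ℝ => φ p.1 • g (p.1 + (p.2 : Circ)))
      ((volume : Measure Circ).prod (volume.restrict (Ioc (0 : ℝ) τ))) := by
    have := (hφc.comp continuous_fst).aestronglyMeasurable
      (μ := (volume : Measure Circ).prod (volume.restrict (Ioc (0 : ℝ) τ)))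
    obtain ⟨C, hC⟩ := isCompact_univ.exists_bound_of_continuousOn hφc.continuousOn
    exact hprod.bdd_smul C this (ae_of_all _ fun p => hC p.1 (mem_univ _))
  have hF2 : Integrable (fun p : Circ × ℝ => circDeriv φ (p.1 - (p.2 : Circ)) • f p.1)
      ((volume : Measure Circ).prod (volume.restrict (Ioc (0 : ℝ) τ))) := by
    have c : Continuous (fun p : Circ × Circ => circDeriv φ (p.1 - p.2) • f p.1) := by fun_prop
    exact integrable_prod_arc (c.integrable_of_hasCompactSupport
      (HasCompactSupport.of_compactSpace _)) h1
  have eR : ∫ x, φ x • ∫ t in (0 : ℝ)..τ, g (x + (t : Circ)) =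
      ∫ t in (0 : ℝ)..τ, ∫ x, φ x • g (x + (t : Circ)) := by
    simp only [intervalIntegral.integral_of_le h0, ← integral_smul]
    exact integral_integral_swap hF
  have eL : ∫ x, (φ x • f (x + (τ : Circ)) - φ x • f x) =
      - ∫ x, (∫ t in (0 : ℝ)..τ, circDeriv φ (x - (t : Circ))) • f x := by
    have e1 : ∀ x : Circ, ∫ t in (0 : ℝ)..τ, circDeriv φ (x - (t : Circ)) =
        φ x - φ (x - (τ : Circ)) := by
      intro x
      have := intervalIntegral.integral_comp_neg (a := (0 : ℝ)) (b := τ)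
        (fun t : ℝ => circDeriv φ (x + (t : Circ)))
      simp only [AddCircle.coe_neg, ← sub_eq_add_neg] at this
      rw [this, integral_circDeriv_eq hφ.hasDerivAt hφ']
      simp [sub_eq_add_neg]
    simp only [e1, sub_smul]
    rw [integral_sub, integral_sub, neg_sub]
    · congr 1
      rw [← integral_add_right_eq_self (fun x => φ (x - (τ : Circ)) • f x) (τ : Circ)]
      simp
    all_goals
      refine Continuous.integrable_of_hasCompactSupport ?_ (HasCompactSupport.of_compactSpace _)
      fun_prop
  rw [eL, eR]
  have e2 : ∫ x, (∫ t in (0 : ℝ)..τ, circDeriv φ (x - (t : Circ))) • f x =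
      ∫ t in (0 : ℝ)..τ, ∫ x, circDeriv φ (x - (t : Circ)) • f x := by
    simp only [intervalIntegral.integral_of_le h0, ← integral_smul_const]
    exact integral_integral_swap hF2
  rw [e2, ← intervalIntegral.integral_neg]
  congr 1
  ext1 t
  -- the weak derivative is tested with the translate of `φ` by `t`
  have e3 := hw _ (isTest_comp_sub hφ t)
  simp only [circDeriv_comp_sub] at e3
  rw [e3, neg_neg, ← integral_add_right_eq_self _ (t : Circ)]
  simp

/-! ### The Sobolev embedding into continuously differentiable functions -/

theorem norm_coe_le (t : ℝ) : ‖(t : Circ)‖ ≤ |t| := by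
  rw [UnitAddCircle.norm_eq]
  simpa using round_le t 0

/-- Increments over distances at most `ε` are bounded by the Gagliardo quotient, also on the
diagonal, where the quotient has the value `0`. -/
theorem norm_sub_le_slobodeckijQuot {σ ε : ℝ} (hσ : 0 ≤ 1 / 2 + σ) (g : Circ → E n)
    {p : Circ × Circ} (hp : ‖p.1 - p.2‖ ≤ ε) :
    ‖g p.1 - g p.2‖ ≤ ε ^ (1 / 2 + σ) * ‖slobodeckijQuot σ g p‖ := by
  rcases eq_or_ne p.1 p.2 with h | h
  · have : 0 ≤ ε := (norm_nonneg _).trans hp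
    rw [h, sub_self, norm_zero]
    positivity
  · have hd : 0 < ‖p.1 - p.2‖ := norm_pos_iff.2 (sub_ne_zero.2 h)
    have hd' : 0 < ‖p.1 - p.2‖ ^ (1 / 2 + σ) := Real.rpow_pos_of_pos hd _
    unfold slobodeckijQuot
    rw [norm_smul, norm_inv, Real.norm_of_nonneg hd'.le]
    have h1 : ‖p.1 - p.2‖ ^ (1 / 2 + σ) ≤ ε ^ (1 / 2 + σ) := Real.rpow_le_rpow hd.le hp hσ
    calc ‖g p.1 - g p.2‖
        = ‖p.1 - p.2‖ ^ (1 / 2 + σ) * ((‖p.1 - p.2‖ ^ (1 / 2 + σ))⁻¹ * ‖g p.1 - g p.2‖) := by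
          field_simp
      _ ≤ _ := by gcongr

/-- A pair of arcs of length at most one is embedded in the torus. -/
theorem measurePreserving_coe_prod_coe (a b : Circ) :
    MeasurePreserving (fun p : ℝ × ℝ => (a + (p.1 : Circ), b + (p.2 : Circ)))
      ((volume.restrict (Ioc (0 : ℝ) 1)).prod (volume.restrict (Ioc (0 : ℝ) 1))) volume := by
  have h := (UnitAddCircle.measurePreserving_mk 0)
  rw [zero_add] at h
  exact ((measurePreserving_add_left volume a).comp h).prod
    ((measurePreserving_add_left volume b).comp h)

/-- The second differences of a function of class `W^{1 + σ, 2}`: the increments over two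
neighbouring arcs are averages of the weak derivative, and the difference of the averages is
estimated by the Cauchy-Schwarz inequality on the product of the arcs. -/
theorem norm_second_difference_le {σ : ℝ} (hσ : 0 < σ) {f g : Circ → E n} (hf : Continuous f)
    (hw : HasWeakDeriv f g) (hg : MemLp g 2 (volume : Measure Circ))
    (hq : MemLp (slobodeckijQuot σ g) 2 volume) {ρ : ℝ} (h0 : 0 < ρ) (h1 : ρ ≤ 1) (x : Circ) :
    ‖(f (x + (ρ : Circ) + (ρ : Circ)) - f (x + (ρ : Circ))) - (f (x + (ρ : Circ)) - f x)‖ ≤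
      (2 * ρ) ^ (1 / 2 + σ) * (eLpNorm (slobodeckijQuot σ g) 2 volume).toReal := by
  set N := (eLpNorm (slobodeckijQuot σ g) 2 volume).toReal with hN
  set μ : Measure ℝ := volume.restrict (Ioc (0 : ℝ) ρ) with hμ
  have hμle : μ ≤ volume.restrict (Ioc (0 : ℝ) 1) :=
    Measure.restrict_mono (Ioc_subset_Ioc_right h1) le_rfl
  have hμ1 : μ univ = ENNReal.ofReal ρ := by simp [hμ]
  have hμr : μ.real univ = ρ := by simp [Measure.real, hμ1, h0.le]
  have hgi : Integrable g := hg.integrable one_le_two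
  have harc : ∀ x : Circ, Integrable (fun t : ℝ => g (x + (t : Circ))) μ := by
    intro x
    have e : Integrable (fun y : Circ => g (x + y)) := hgi.comp_add_left x
    have := UnitAddCircle.measurePreserving_mk 0
    rw [zero_add] at this
    exact (this.integrable_comp_of_integrable e).mono_measure hμle
  have hae := hw.sub_ae_eq hf hg h0.le h1
  have hae' := (measurePreserving_add_right volume (ρ : Circ)).quasiMeasurePreserving.ae hae
  have main : ∀ᵐ x : Circ,
      ‖(f (x + (ρ : Circ) + (ρ : Circ)) - f (x + (ρ : Circ))) - (f (x + (ρ : Circ)) - f x)‖ ≤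
        (2 * ρ) ^ (1 / 2 + σ) * N := by
    filter_upwards [hae, hae'] with x hx hx'
    rw [hx, hx', intervalIntegral.integral_of_le h0.le, intervalIntegral.integral_of_le h0.le]
    set G : ℝ × ℝ → E n := fun p => g (x + (ρ : Circ) + (p.1 : Circ)) - g (x + (p.2 : Circ))
    set S : ℝ × ℝ → E n := fun p =>
      slobodeckijQuot σ g (x + (ρ : Circ) + (p.1 : Circ), x + (p.2 : Circ)) with hS
    have hmp := measurePreserving_coe_prod_coe (x + (ρ : Circ)) x
    have hle : μ.prod μ ≤ (volume.restrict (Ioc (0 : ℝ) 1)).prod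
        (volume.restrict (Ioc (0 : ℝ) 1)) := Measure.prod_mono hμle hμle
    have hSm : MemLp S 2 (μ.prod μ) := (hq.comp_measurePreserving hmp).mono_measure hle
    have hSn : eLpNorm S 2 (μ.prod μ) ≤ eLpNorm (slobodeckijQuot σ g) 2 volume := by
      rw [← eLpNorm_comp_measurePreserving hq.1 hmp]
      exact eLpNorm_mono_measure _ hle
    have hS1 : ∫ p, ‖S p‖ ∂(μ.prod μ) ≤ N * ρ := by
      rw [integral_norm_eq_lintegral_enorm hSm.1, ← eLpNorm_one_eq_lintegral_enorm]
      have hfin : eLpNorm (slobodeckijQuot σ g) 2 volume * ENNReal.ofReal ρ ≠ ⊤ :=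
        ENNReal.mul_ne_top hq.2.ne ENNReal.ofReal_ne_top
      have := ENNReal.toReal_mono hfin (show eLpNorm S 1 (μ.prod μ) ≤ _ from ?_)
      · simpa [ENNReal.toReal_ofReal h0.le] using this
      · refine (eLpNorm_le_eLpNorm_mul_rpow_measure_univ (one_le_two) hSm.1).trans ?_
        refine mul_le_mul' hSn ?_
        rw [← univ_prod_univ, Measure.prod_prod, hμ1, ← sq, ← ENNReal.rpow_natCast,
          ← ENNReal.rpow_mul]
        norm_num
    -- the difference of two averages is an average over the product of the arcs
    have hG : ρ • (∫ t in Ioc (0 : ℝ) ρ, g (x + (ρ : Circ) + (t : Circ))) -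
        ρ • ∫ t in Ioc (0 : ℝ) ρ, g (x + (t : Circ)) = ∫ p, G p ∂(μ.prod μ) := by
      have e1 := integral_fun_fst (μ := μ) (ν := μ)
        (fun t : ℝ => g (x + (ρ : Circ) + (t : Circ)))
      have e2 := integral_fun_snd (μ := μ) (ν := μ) (fun t : ℝ => g (x + (t : Circ)))
      rw [hμr] at e1 e2
      rw [← e1, ← e2, ← integral_sub ((harc _).comp_fst μ) ((harc _).comp_snd μ)]
    have hb : ‖∫ p, G p ∂(μ.prod μ)‖ ≤ (2 * ρ) ^ (1 / 2 + σ) * (N * ρ) := by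
      calc ‖∫ p, G p ∂(μ.prod μ)‖ ≤ ∫ p, (2 * ρ) ^ (1 / 2 + σ) * ‖S p‖ ∂(μ.prod μ) := by
            refine norm_integral_le_of_norm_le
              ((hSm.integrable one_le_two).norm.const_mul _) ?_
            rw [hμ, Measure.prod_restrict]
            filter_upwards [ae_restrict_mem (measurableSet_Ioc.prod measurableSet_Ioc)]
              with p hp
            apply norm_sub_le_slobodeckijQuot
              (p := (x + (ρ : Circ) + (p.1 : Circ), x + (p.2 : Circ)))
              (by linarith)
            have e : x + (ρ : Circ) + (p.1 : Circ) - (x + (p.2 : Circ)) =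
                ((ρ + p.1 - p.2 : ℝ) : Circ) := by
              rw [AddCircle.coe_sub, AddCircle.coe_add]; abel
            simp only
            rw [e]
            refine (norm_coe_le _).trans ?_
            rw [abs_le]
            obtain ⟨⟨h1, h2⟩, h3, h4⟩ := hp
            constructor <;> linarith
        _ = (2 * ρ) ^ (1 / 2 + σ) * ∫ p, ‖S p‖ ∂(μ.prod μ) := integral_const_mul _ _
        _ ≤ _ := by gcongr
    rw [← hG, ← smul_sub, norm_smul, Real.norm_of_nonneg h0.le] at hb
    refine le_of_mul_le_mul_left ?_ h0
    linarith
  -- both sides are continuous in `x`, so that the inequality holds everywhere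
  have hcl : IsClosed {x : Circ |
      ‖(f (x + (ρ : Circ) + (ρ : Circ)) - f (x + (ρ : Circ))) - (f (x + (ρ : Circ)) - f x)‖ ≤
        (2 * ρ) ^ (1 / 2 + σ) * N} := isClosed_le (by fun_prop) continuous_const
  have hd := Measure.dense_of_ae main
  rw [dense_iff_closure_eq, hcl.closure_eq] at hd
  exact eq_univ_iff_forall.1 hd x

/-- The constant of the Sobolev embedding `H^{1 + σ} ⊂ C¹`, `σ > 1/2`. -/
def morreyConst (σ : ℝ) : ℝ := 1 / (1 - 2 ^ (1 / 2 - σ))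

/-- The Sobolev embedding `W^{1 + σ, 2} ⊂ C¹` for `σ > 1/2`: the difference quotients with steps
`2⁻ᵏ` converge uniformly. The first of them vanishes by periodicity, so that the derivative is
bounded by the Gagliardo seminorm alone. -/
theorem exists_hasDerivAt_of_hasWeakDeriv {σ : ℝ} (hσ : 1 / 2 < σ) {f g : Circ → E n}
    (hf : Continuous f) (hw : HasWeakDeriv f g) (hg : MemLp g 2 (volume : Measure Circ))
    (hq : MemLp (slobodeckijQuot σ g) 2 volume) :
    ∃ G : C(Circ, E n), (∀ t : ℝ, HasDerivAt (fun u : ℝ => f (u : Circ)) (G (t : Circ)) t) ∧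
      ‖G‖ ≤ morreyConst σ * (eLpNorm (slobodeckijQuot σ g) 2 volume).toReal := by
  set N := (eLpNorm (slobodeckijQuot σ g) 2 volume).toReal with hN
  set r : ℝ := 2 ^ (1 / 2 - σ) with hr
  have hr1 : r < 1 := Real.rpow_lt_one_of_one_lt_of_neg one_lt_two (by linarith)
  let δ : ℕ → ℝ := fun k => (2 ^ k)⁻¹
  have hδ0 : ∀ k, 0 < δ k := fun k => by positivity
  have hδ1 : ∀ k, δ k ≤ 1 := fun k => inv_le_one_of_one_le₀ (one_le_pow₀ one_le_two)
  have hδs : ∀ k, δ k = δ (k + 1) + δ (k + 1) := fun k => by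
    simp only [δ, pow_succ]; field_simp; norm_num
  let u : ℕ → C(Circ, E n) := fun k =>
    ⟨fun x => (δ k)⁻¹ • (f (x + ((δ k : ℝ) : Circ)) - f x), by fun_prop⟩
  have hu : ∀ k, dist (u k) (u (k + 1)) ≤ N * r ^ k := by
    intro k
    rw [dist_eq_norm, ContinuousMap.norm_le _ (by positivity)]
    intro x
    have h2 := norm_second_difference_le (by linarith : 0 < σ) hf hw hg hq (hδ0 (k + 1))
      (hδ1 (k + 1)) x
    have e : (u k - u (k + 1)) x = (δ k)⁻¹ •
        ((f (x + ((δ (k + 1) : ℝ) : Circ) + ((δ (k + 1) : ℝ) : Circ)) -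
          f (x + ((δ (k + 1) : ℝ) : Circ))) - (f (x + ((δ (k + 1) : ℝ) : Circ)) - f x)) := by
      have e1 : (δ (k + 1))⁻¹ = 2 * (δ k)⁻¹ := by simp [δ, pow_succ, mul_comm]
      have e2 : x + ((δ (k + 1) : ℝ) : Circ) + ((δ (k + 1) : ℝ) : Circ) =
          x + ((δ k : ℝ) : Circ) := by
        rw [hδs k, AddCircle.coe_add, add_assoc]
      change (δ k)⁻¹ • (f (x + ((δ k : ℝ) : Circ)) - f x) -
        (δ (k + 1))⁻¹ • (f (x + ((δ (k + 1) : ℝ) : Circ)) - f x) = _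
      rw [e1, e2]
      module
    rw [e, norm_smul, norm_inv, Real.norm_of_nonneg (hδ0 k).le]
    calc _ ≤ (δ k)⁻¹ * ((2 * δ (k + 1)) ^ (1 / 2 + σ) * N) := by
          have := (inv_pos.2 (hδ0 k)).le
          gcongr
      _ = N * r ^ k := by
          have e3 : 2 * δ (k + 1) = 2 ^ (-(k : ℝ)) := by
            rw [two_mul, ← hδs k, Real.rpow_neg zero_le_two, Real.rpow_natCast]
          have e4 : (δ k)⁻¹ = (2 : ℝ) ^ (k : ℝ) := by simp [δ]
          rw [e3, e4, hr, ← Real.rpow_mul_natCast zero_le_two, ← Real.rpow_mul zero_le_two,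
            ← mul_assoc, ← Real.rpow_add zero_lt_two, mul_comm N]
          congr 2
          ring
  obtain ⟨G, hG⟩ := cauchySeq_tendsto_of_complete (cauchySeq_of_le_geometric r N hr1 hu)
  refine ⟨G, ?_, ?_⟩
  · have hF : Continuous (fun t : ℝ => f (t : Circ)) := hf.comp coe_continuous
    have hI : ∀ t : ℝ, HasDerivAt (fun b : ℝ => ∫ v in (0 : ℝ)..b, f (v : Circ)) (f (t : Circ)) t :=
      fun t => intervalIntegral.integral_hasDerivAt_right (hF.intervalIntegrable _ _)
        hF.stronglyMeasurable.stronglyMeasurableAtFilter hF.continuousAt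
    -- the Steklov means of `f` over arcs of length `δ k` have the derivatives `u k`
    refine hasDerivAt_of_tendstoUniformly (l := atTop)
      (f := fun k t => (δ k)⁻¹ • ((∫ v in (0 : ℝ)..(t + δ k), f (v : Circ)) -
        ∫ v in (0 : ℝ)..t, f (v : Circ)))
      (f' := fun k t => u k (t : Circ)) ?_ (Eventually.of_forall fun k t => ?_) ?_
    · have := ContinuousMap.tendsto_iff_tendstoUniformly.1 hG
      exact this.comp (fun t : ℝ => (t : Circ))
    · have h1 := (hI (t + δ k)).comp_add_const t (δ k)
      have h2 := (h1.sub (hI t)).const_smul ((δ k)⁻¹)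
      simpa [u] using! h2
    · intro t
      have h1 := hasDerivAt_iff_tendsto_slope_zero.1 (hI t)
      have h2 : Tendsto δ atTop (𝓝[≠] 0) := by
        refine tendsto_nhdsWithin_iff.2 ⟨?_, Eventually.of_forall fun k => (hδ0 k).ne'⟩
        simp only [δ, ← inv_pow]
        exact tendsto_pow_atTop_nhds_zero_of_lt_one (by norm_num) (by norm_num)
      exact h1.comp h2
  · have h0 : u 0 = 0 := by
      ext1 x
      simp [u, δ, AddCircle.coe_period]
    have := dist_le_of_le_geometric_of_tendsto₀ r N hr1 hu hG
    rw [h0, dist_zero_left] at this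
    rw [morreyConst, ← hr]
    linarith [show 1 / (1 - r) * N = N / (1 - r) by ring]

/-- A continuously differentiable function has its classical derivative as weak derivative. -/
theorem hasWeakDeriv_of_hasDerivAt {f g : Circ → E n} (hf : Continuous f) (hg : Continuous g)
    (h : ∀ t : ℝ, HasDerivAt (fun u : ℝ => f (u : Circ)) (g (t : Circ)) t) :
    HasWeakDeriv f g := by
  intro φ hφ
  have hφ' := hφ.continuous_circDeriv
  have hφc := hφ.continuous
  have e : ∀ t : ℝ, HasDerivAt (fun u : ℝ => φ (u : Circ) • f (u : Circ))
      (φ (t : Circ) • g (t : Circ) + circDeriv φ (t : Circ) • f (t : Circ)) t :=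
    fun t => (hφ.hasDerivAt t).smul (h t)
  have h1 := integral_circDeriv_eq (f := fun x => φ x • f x)
    (g := fun x => φ x • g x + circDeriv φ x • f x) e (by fun_prop) 0 0 1
  simp only [zero_add, AddCircle.coe_period, AddCircle.coe_zero, sub_self] at h1
  have h2 := UnitAddCircle.intervalIntegral_preimage 0
    (fun x => φ x • g x + circDeriv φ x • f x)
  rw [zero_add] at h2
  rw [h2, integral_add] at h1
  · exact eq_neg_of_add_eq_zero_right h1
  all_goals
    refine Continuous.integrable_of_hasCompactSupport ?_ (HasCompactSupport.of_compactSpace _)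
    fun_prop

/-! ### Taylor remainders and the Gagliardo seminorm -/

/-- The representative of a point of the circle in `(-1/2, 1/2]`: the signed arclength from `0`. -/
def signedRep (z : Circ) : ℝ := (AddCircle.measurableEquivIoc 1 (-(1 / 2)) z : ℝ)

theorem measurable_signedRep : Measurable signedRep :=
  measurable_subtype_coe.comp (AddCircle.measurableEquivIoc 1 (-(1 / 2))).measurable

theorem coe_signedRep (z : Circ) : (signedRep z : Circ) = z :=
  AddCircle.coe_equivIoc (p := 1) (a := -(1 / 2))

theorem signedRep_mem (z : Circ) : signedRep z ∈ Ioc (-(1 / 2) : ℝ) (1 / 2) := by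
  have := (AddCircle.measurableEquivIoc 1 (-(1 / 2)) z).2
  norm_num at this ⊢
  exact this

theorem norm_coe_of_mem {t : ℝ} (ht : t ∈ Ioc (-(1 / 2) : ℝ) (1 / 2)) : ‖(t : Circ)‖ = |t| := by
  rw [AddCircle.norm_coe_eq_abs_iff 1 one_ne_zero, abs_one, abs_le]
  exact ⟨ht.1.le, ht.2⟩

theorem abs_signedRep (z : Circ) : |signedRep z| = ‖z‖ := by
  rw [← norm_coe_of_mem (signedRep_mem z), coe_signedRep]

theorem signedRep_coe {t : ℝ} (ht : t ∈ Ioc (-(1 / 2) : ℝ) (1 / 2)) : signedRep (t : Circ) = t := by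
  have h : t ∈ Ioc (-(1 / 2) : ℝ) (-(1 / 2) + 1) := by norm_num at ht ⊢; exact ht
  exact congrArg Subtype.val (AddCircle.equivIoc_coe_eq (p := 1) h)

/-- The first order Taylor remainder `h(y) - h(x) - (y - x) h'(x)`, divided by
`|y - x|^(s + 1/2)`. Here `y - x` is the signed arclength and `g` stands for `h'`. -/
def taylorQuot (s : ℝ) (h g : Circ → E n) (p : Circ × Circ) : E n :=
  (‖p.2 - p.1‖ ^ (s + 1 / 2))⁻¹ • (h p.2 - h p.1 - signedRep (p.2 - p.1) • g p.1)

theorem eLpNorm_two_sq {α F : Type*} [MeasurableSpace α] [NormedAddCommGroup F] (f : α → F)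
    (μ : Measure α) : eLpNorm f 2 μ ^ 2 = ∫⁻ a, ‖f a‖ₑ ^ 2 ∂μ := by
  have := eLpNorm_nnreal_pow_eq_lintegral (f := f) (μ := μ) (p := 2) two_ne_zero
  simpa using this

/-- The `L²` modulus of continuity of a function on the circle, squared. -/
def sqModulus (g : Circ → E n) (z : Circ) : ℝ≥0∞ := ∫⁻ x, ‖g (x + z) - g x‖ₑ ^ 2

theorem measurable_sqModulus {g : Circ → E n} (hg : Continuous g) : Measurable (sqModulus g) := by
  unfold sqModulus
  apply Measurable.lintegral_prod_left'
    (f := fun p : Circ × Circ => ‖g (p.1 + p.2) - g p.1‖ₑ ^ 2)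
  have : Continuous (fun p : Circ × Circ => g (p.1 + p.2) - g p.1) := by fun_prop
  exact this.measurable.enorm.pow_const 2

/-- The kernel `r^(-(2s - 1))` of the Gagliardo seminorm of order `s - 1`. -/
def gagliardoKernel (s r : ℝ) : ℝ≥0∞ := ENNReal.ofReal ((r ^ (1 / 2 + (s - 1)))⁻¹) ^ 2

theorem measurable_gagliardoKernel (s : ℝ) : Measurable (gagliardoKernel s) := by
  unfold gagliardoKernel
  fun_prop

/-- Homogeneity of the kernel, of degree `-(2s - 1) ≤ -1`. -/
theorem gagliardoKernel_le_mul {s : ℝ} (hs : 1 ≤ s) {θ r : ℝ} (h0 : 0 < θ) (h1 : θ ≤ 1)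
    (hr : 0 ≤ r) : gagliardoKernel s r ≤ ENNReal.ofReal θ * gagliardoKernel s (θ * r) := by
  unfold gagliardoKernel
  set e := 1 / 2 + (s - 1) with he
  rw [← ENNReal.ofReal_pow (by positivity), ← ENNReal.ofReal_pow (by positivity),
    ← ENNReal.ofReal_mul h0.le]
  apply ENNReal.ofReal_le_ofReal
  rw [Real.mul_rpow h0.le hr, mul_inv, mul_pow, ← mul_assoc]
  refine le_mul_of_one_le_left (by positivity) ?_
  have h2 : (θ ^ e) ^ 2 ≤ θ := by
    rw [← Real.rpow_mul_natCast h0.le]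
    calc θ ^ (e * (2 : ℕ)) ≤ θ ^ (1 : ℝ) :=
          Real.rpow_le_rpow_of_exponent_ge h0 h1 (by rw [he]; push_cast; linarith)
      _ = θ := Real.rpow_one θ
  rw [inv_pow, ← div_eq_mul_inv]
  exact (one_le_div (by positivity)).2 h2

theorem lintegral_prod_eq_translate {H : Circ × Circ → ℝ≥0∞} (hH : Measurable H) :
    ∫⁻ p, H p = ∫⁻ z, ∫⁻ x, H (x, x + z) := by
  have h := measurePreserving_prod_add (volume : Measure Circ) (volume : Measure Circ)
  have e := h.lintegral_comp hH
  rw [Measure.volume_eq_prod, ← e, lintegral_prod_symm']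
  exact hH.comp h.measurable

theorem lintegral_signedRep {H : Circ → ℝ≥0∞} (hH : Measurable H) :
    ∫⁻ z, H z = ∫⁻ t in Ioc (-(1 / 2) : ℝ) (1 / 2), H (t : Circ) := by
  have h := UnitAddCircle.measurePreserving_mk (-(1 / 2))
  rw [← h.lintegral_comp hH]
  norm_num

/-- The Gagliardo seminorm as an integral over displacements. -/
theorem lintegral_slobodeckijQuot_sq {g : Circ → E n} (hg : Continuous g) (s : ℝ) :
    ∫⁻ p, ‖slobodeckijQuot (s - 1) g p‖ₑ ^ 2 =
      ∫⁻ t in Ioc (-(1 / 2) : ℝ) (1 / 2), gagliardoKernel s |t| * sqModulus g (t : Circ) := by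
  have hm : Measurable (slobodeckijQuot (s - 1) g) := by
    unfold slobodeckijQuot
    have := hg.measurable
    fun_prop
  rw [lintegral_prod_eq_translate (hm.enorm.pow_const 2)]
  have e : ∀ z : Circ, ∫⁻ x, ‖slobodeckijQuot (s - 1) g (x, x + z)‖ₑ ^ 2 =
      gagliardoKernel s ‖z‖ * sqModulus g z := by
    intro z
    unfold sqModulus
    rw [← lintegral_const_mul']
    · congr 1
      ext1 x
      simp only [slobodeckijQuot, gagliardoKernel]
      rw [enorm_smul, mul_pow, ← enorm_neg (g x - _), neg_sub, sub_add_cancel_left, norm_neg,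
        Real.enorm_of_nonneg (by positivity)]
    · exact ENNReal.pow_ne_top ENNReal.ofReal_ne_top
  simp only [e]
  rw [lintegral_signedRep]
  · refine setLIntegral_congr_fun measurableSet_Ioc fun t ht => ?_
    simp only [norm_coe_of_mem ht]
  · exact ((measurable_gagliardoKernel s).comp measurable_norm).mul (measurable_sqModulus hg)

/-- The integral form of the first order Taylor remainder, estimated by Jensen's inequality. -/
theorem enorm_taylor_sq_le {h g : Circ → E n} (hg : Continuous g)
    (hd : ∀ t : ℝ, HasDerivAt (fun u : ℝ => h (u : Circ)) (g (t : Circ)) t) (x : Circ) (t : ℝ) :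
    ‖h (x + (t : Circ)) - h x - t • g x‖ₑ ^ 2 ≤
      ‖t‖ₑ ^ 2 * ∫⁻ θ in Ioc (0 : ℝ) 1, ‖g (x + ((θ * t : ℝ) : Circ)) - g x‖ₑ ^ 2 := by
  set D : ℝ → E n := fun θ => g (x + ((θ * t : ℝ) : Circ)) - g x with hD
  have hc : Continuous (fun θ : ℝ => ((θ * t : ℝ) : Circ)) :=
    coe_continuous.comp (continuous_id.mul continuous_const)
  have hDc : Continuous D := by fun_prop
  have e : h (x + (t : Circ)) - h x - t • g x = t • ∫ θ in Ioc (0 : ℝ) 1, D θ := by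
    have h1 := intervalIntegral.integral_comp_mul_right (fun v : ℝ => g (x + (v : Circ)))
      (a := 0) (b := 1) (c := t)
    have h2 := integral_circDeriv_eq hd hg x 0 t
    rw [← intervalIntegral.integral_of_le zero_le_one, hD, intervalIntegral.integral_sub,
      smul_sub, ← intervalIntegral.integral_smul]
    · have h3 := intervalIntegral.smul_integral_comp_mul_right (fun v : ℝ => g (x + (v : Circ)))
        (a := 0) (b := 1) t
      rw [intervalIntegral.integral_smul, h3]
      simp [h2]
    · apply Continuous.intervalIntegrable; fun_prop
    · apply Continuous.intervalIntegrable; fun_prop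
  have : IsProbabilityMeasure (volume.restrict (Ioc (0 : ℝ) 1)) := ⟨by simp⟩
  rw [e, enorm_smul, mul_pow, ← eLpNorm_two_sq]
  gcongr
  calc ‖∫ θ in Ioc (0 : ℝ) 1, D θ‖ₑ ≤ ∫⁻ θ in Ioc (0 : ℝ) 1, ‖D θ‖ₑ :=
        enorm_integral_le_lintegral_enorm _
    _ = eLpNorm D 1 (volume.restrict (Ioc (0 : ℝ) 1)) := eLpNorm_one_eq_lintegral_enorm.symm
    _ ≤ _ := eLpNorm_le_eLpNorm_of_exponent_le one_le_two hDc.aestronglyMeasurable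

theorem measurable_taylorQuot {h g : Circ → E n} (hh : Continuous h) (hg : Continuous g) (s : ℝ) :
    Measurable (taylorQuot s h g) := by
  have h1 := hh.measurable
  have h2 := hg.measurable
  have h3 := measurable_signedRep
  unfold taylorQuot
  fun_prop

/-- Hardy's inequality for the Taylor remainder: the quotient `taylorQuot` is bounded in `L²` by the
Gagliardo seminorm of the derivative. The Taylor remainder at distance `t` is an average over
`θ ∈ (0, 1)` of increments of the derivative at distance `θ t`, and rescaling by `θ` only
decreases the Gagliardo integral. -/
theorem eLpNorm_taylorQuot_le {s : ℝ} (hs : 1 ≤ s) {h g : Circ → E n} (hh : Continuous h)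
    (hg : Continuous g)
    (hd : ∀ t : ℝ, HasDerivAt (fun u : ℝ => h (u : Circ)) (g (t : Circ)) t) :
    eLpNorm (taylorQuot s h g) 2 volume ≤ eLpNorm (slobodeckijQuot (s - 1) g) 2 volume := by
  rw [← ENNReal.pow_le_pow_left_iff two_ne_zero, eLpNorm_two_sq, eLpNorm_two_sq,
    lintegral_slobodeckijQuot_sq hg]
  set μ : Measure ℝ := volume.restrict (Ioc (-(1 / 2) : ℝ) (1 / 2)) with hμ
  set K : ℝ → ℝ≥0∞ := fun t => gagliardoKernel s |t| * sqModulus g (t : Circ) with hK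
  have hKm : Measurable K := ((measurable_gagliardoKernel s).comp measurable_norm).mul
    ((measurable_sqModulus hg).comp coe_continuous.measurable)
  have hc : Continuous (fun p : ℝ × ℝ => ((p.2 * p.1 : ℝ) : Circ)) :=
    coe_continuous.comp (continuous_snd.mul continuous_fst)
  -- the integral over `x` for a fixed displacement `t`
  have step1 : ∀ t ∈ Ioc (-(1 / 2) : ℝ) (1 / 2),
      ∫⁻ x, ‖taylorQuot s h g (x, x + (t : Circ))‖ₑ ^ 2 ≤
        ∫⁻ θ in Ioc (0 : ℝ) 1, gagliardoKernel s |t| * sqModulus g ((θ * t : ℝ) : Circ) := by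
    intro t ht
    have hker : ENNReal.ofReal ((|t| ^ (s + 1 / 2))⁻¹) ^ 2 * ‖t‖ₑ ^ 2 = gagliardoKernel s |t| := by
      rw [gagliardoKernel, ← mul_pow, ← ofReal_norm, ← ENNReal.ofReal_mul (by positivity),
        Real.norm_eq_abs]
      congr 2
      rcases eq_or_lt_of_le (abs_nonneg t) with h0 | h0
      · rw [← h0, mul_zero, Real.zero_rpow (by linarith), inv_zero]
      · rw [show s + 1 / 2 = 1 / 2 + (s - 1) + 1 by ring, Real.rpow_add_one h0.ne']
        field_simp
    rw [lintegral_const_mul' (gagliardoKernel s |t|) _ (ENNReal.pow_ne_top ENNReal.ofReal_ne_top),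
      ← hker, mul_assoc]
    have e1 : ∀ x, ‖taylorQuot s h g (x, x + (t : Circ))‖ₑ ^ 2 =
        ENNReal.ofReal ((|t| ^ (s + 1 / 2))⁻¹) ^ 2 *
          ‖h (x + (t : Circ)) - h x - t • g x‖ₑ ^ 2 := by
      intro x
      simp only [taylorQuot, add_sub_cancel_left, signedRep_coe ht, norm_coe_of_mem ht]
      rw [enorm_smul, mul_pow, Real.enorm_of_nonneg (by positivity)]
    simp only [e1]
    rw [lintegral_const_mul' _ _ (ENNReal.pow_ne_top ENNReal.ofReal_ne_top)]
    gcongr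
    refine (lintegral_mono fun x => enorm_taylor_sq_le hg hd x t).trans ?_
    rw [lintegral_const_mul' _ _ (ENNReal.pow_ne_top enorm_ne_top)]
    gcongr
    rw [lintegral_lintegral_swap]
    · rfl
    · have hc' : Continuous (fun p : Circ × ℝ => ((p.2 * t : ℝ) : Circ)) :=
        coe_continuous.comp (continuous_snd.mul continuous_const)
      have : Continuous (fun p : Circ × ℝ => g (p.1 + ((p.2 * t : ℝ) : Circ)) - g p.1) := by
        fun_prop
      exact (this.measurable.enorm.pow_const 2).aemeasurable
  -- the integral over `t` for a fixed `θ`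
  have step2 : ∀ θ ∈ Ioc (0 : ℝ) 1,
      ∫⁻ t, gagliardoKernel s |t| * sqModulus g ((θ * t : ℝ) : Circ) ∂μ ≤ ∫⁻ t, K t ∂μ := by
    rintro θ ⟨h0, h1⟩
    have hind : Measurable ((Ioc (-(1 / 2) : ℝ) (1 / 2)).indicator K) :=
      hKm.indicator measurableSet_Ioc
    calc ∫⁻ t, gagliardoKernel s |t| * sqModulus g ((θ * t : ℝ) : Circ) ∂μ
        ≤ ∫⁻ t, ENNReal.ofReal θ * (Ioc (-(1 / 2) : ℝ) (1 / 2)).indicator K (θ * t) ∂μ := by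
          refine setLIntegral_mono' measurableSet_Ioc fun t ht => ?_
          have hmem : θ * t ∈ Ioc (-(1 / 2) : ℝ) (1 / 2) :=
            ⟨by nlinarith [ht.1, ht.2], by nlinarith [ht.1, ht.2]⟩
          rw [indicator_of_mem hmem, hK, ← mul_assoc, abs_mul, abs_of_pos h0]
          gcongr
          exact gagliardoKernel_le_mul hs h0 h1 (abs_nonneg t)
      _ ≤ ∫⁻ t, ENNReal.ofReal θ * (Ioc (-(1 / 2) : ℝ) (1 / 2)).indicator K (θ * t) :=
          setLIntegral_le_lintegral _ _
      _ = ENNReal.ofReal θ * ∫⁻ t, (Ioc (-(1 / 2) : ℝ) (1 / 2)).indicator K (θ * t) :=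
          lintegral_const_mul' _ _ ENNReal.ofReal_ne_top
      _ = ENNReal.ofReal θ * (ENNReal.ofReal |θ⁻¹| *
            ∫⁻ t, (Ioc (-(1 / 2) : ℝ) (1 / 2)).indicator K t) := by
          rw [← lintegral_map hind (measurable_const_mul θ), Real.map_volume_mul_left h0.ne',
            lintegral_smul_measure, smul_eq_mul]
      _ = ∫⁻ t, K t ∂μ := by
          rw [← mul_assoc, ← ENNReal.ofReal_mul h0.le, abs_of_pos (inv_pos.2 h0),
            mul_inv_cancel₀ h0.ne', ENNReal.ofReal_one, one_mul,
            lintegral_indicator measurableSet_Ioc]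
  rw [lintegral_prod_eq_translate ((measurable_taylorQuot hh hg s).enorm.pow_const 2),
    lintegral_signedRep]
  · calc _ ≤ ∫⁻ t, (∫⁻ θ in Ioc (0 : ℝ) 1,
          gagliardoKernel s |t| * sqModulus g ((θ * t : ℝ) : Circ)) ∂μ :=
          setLIntegral_mono' measurableSet_Ioc step1
      _ = ∫⁻ θ in Ioc (0 : ℝ) 1, (∫⁻ t,
          gagliardoKernel s |t| * sqModulus g ((θ * t : ℝ) : Circ) ∂μ) := by
          refine lintegral_lintegral_swap (Measurable.aemeasurable ?_)
          exact (((measurable_gagliardoKernel s).comp measurable_norm).comp measurable_fst).mul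
            ((measurable_sqModulus hg).comp hc.measurable)
      _ ≤ ∫⁻ θ in Ioc (0 : ℝ) 1, ∫⁻ t, K t ∂μ := setLIntegral_mono' measurableSet_Ioc step2
      _ = ∫⁻ t, K t ∂μ := by simp
  · apply Measurable.lintegral_prod_left'
      (f := fun p : Circ × Circ => ‖taylorQuot s h g (p.1, p.1 + p.2)‖ₑ ^ 2)
    have : Measurable (fun p : Circ × Circ => (p.1, p.1 + p.2)) := by fun_prop
    exact ((measurable_taylorQuot hh hg s).comp this).enorm.pow_const 2

/-! ### Embedded curves form an open set -/

namespace Hs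

theorem norm_sq_eq (f : Hs s n) : ‖f‖ ^ 2 = ‖toL2 f‖ ^ 2 + (‖derivL2 f‖ ^ 2 + ‖quotL2 f‖ ^ 2) := by
  have h : ‖f‖ = ‖graph f‖ := rfl
  rw [h, WithLp.prod_norm_sq_eq_of_L2, WithLp.prod_norm_sq_eq_of_L2]
  rfl

theorem norm_toL2_le (f : Hs s n) : ‖toL2 f‖ ≤ ‖f‖ := by
  refine le_of_sq_le_sq ?_ (norm_nonneg _)
  rw [norm_sq_eq f]
  nlinarith [sq_nonneg ‖derivL2 f‖, sq_nonneg ‖quotL2 f‖]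

theorem norm_quotL2_le (f : Hs s n) : ‖quotL2 f‖ ≤ ‖f‖ := by
  refine le_of_sq_le_sq ?_ (norm_nonneg _)
  rw [norm_sq_eq f]
  nlinarith [sq_nonneg ‖derivL2 f‖, sq_nonneg ‖toL2 f‖]

theorem toReal_eLpNorm_quot_le (f : Hs s n) :
    (eLpNorm (slobodeckijQuot (s - 1) f.weakDeriv) 2 volume).toReal ≤ ‖f‖ := by
  rw [← Lp.norm_toLp _ f.isSobolevDeriv.quot_memLp]
  exact f.norm_quotL2_le

/-- Functions in `H^s`, `s > 3/2`, are continuously differentiable, and the classical derivative is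
bounded by the norm. -/
theorem exists_deriv (hs : 3 / 2 < s) (f : Hs s n) :
    ∃ G : C(Circ, E n), (∀ t : ℝ, HasDerivAt (fun u : ℝ => f (u : Circ)) (G (t : Circ)) t) ∧
      ‖G‖ ≤ morreyConst (s - 1) * ‖f‖ := by
  have h := f.isSobolevDeriv
  obtain ⟨G, h1, h2⟩ := exists_hasDerivAt_of_hasWeakDeriv (by linarith : 1 / 2 < s - 1)
    f.continuous h.weak h.memLp h.quot_memLp
  refine ⟨G, h1, h2.trans ?_⟩
  have : 0 ≤ morreyConst (s - 1) := by
    unfold morreyConst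
    have : (2 : ℝ) ^ (1 / 2 - (s - 1)) < 1 :=
      Real.rpow_lt_one_of_one_lt_of_neg one_lt_two (by linarith)
    exact one_div_nonneg.2 (by linarith)
  exact mul_le_mul_of_nonneg_left f.toReal_eLpNorm_quot_le this

theorem hasDerivAt (hs : 3 / 2 < s) (f : Hs s n) (t : ℝ) :
    HasDerivAt (fun u : ℝ => f (u : Circ)) (circDeriv f.toFun (t : Circ)) t := by
  obtain ⟨G, h1, -⟩ := f.exists_deriv hs
  rw [circDeriv_eq_of_hasDerivAt h1]
  exact h1 t

theorem continuous_circDeriv (hs : 3 / 2 < s) (f : Hs s n) : Continuous (circDeriv f.toFun) := by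
  obtain ⟨G, h1, -⟩ := f.exists_deriv hs
  rw [circDeriv_eq_of_hasDerivAt h1]
  exact G.continuous

theorem norm_circDeriv_le (hs : 3 / 2 < s) (f : Hs s n) (x : Circ) :
    ‖circDeriv f.toFun x‖ ≤ morreyConst (s - 1) * ‖f‖ := by
  obtain ⟨G, h1, h2⟩ := f.exists_deriv hs
  rw [circDeriv_eq_of_hasDerivAt h1]
  exact (G.norm_coe_le_norm x).trans h2

theorem circDeriv_add (hs : 3 / 2 < s) (f g : Hs s n) :
    circDeriv (f + g).toFun = circDeriv f.toFun + circDeriv g.toFun :=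
  circDeriv_eq_of_hasDerivAt fun t => (f.hasDerivAt hs t).add (g.hasDerivAt hs t)

theorem circDeriv_smul (hs : 3 / 2 < s) (c : ℝ) (f : Hs s n) :
    circDeriv (c • f).toFun = c • circDeriv f.toFun :=
  circDeriv_eq_of_hasDerivAt fun t => (f.hasDerivAt hs t).const_smul c

theorem weakDeriv_ae_eq (hs : 3 / 2 < s) (f : Hs s n) :
    f.weakDeriv =ᵐ[volume] circDeriv f.toFun :=
  f.isSobolevDeriv.weak.ae_eq
    (hasWeakDeriv_of_hasDerivAt f.continuous (f.continuous_circDeriv hs) (f.hasDerivAt hs))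
    f.isSobolevDeriv.memLp (memLp_of_continuous (f.continuous_circDeriv hs))

theorem norm_sub_le (hs : 3 / 2 < s) (f : Hs s n) (x y : Circ) :
    ‖f y - f x‖ ≤ morreyConst (s - 1) * ‖f‖ * ‖y - x‖ := by
  have h := integral_circDeriv_eq (f.hasDerivAt hs) (f.continuous_circDeriv hs) x 0
    (signedRep (y - x))
  rw [coe_signedRep, AddCircle.coe_zero, add_zero, add_sub_cancel] at h
  rw [← h]
  have := intervalIntegral.norm_integral_le_of_norm_le_const (a := 0) (b := signedRep (y - x))
    (f := fun t : ℝ => circDeriv f.toFun (x + (t : Circ)))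
    (fun t _ => f.norm_circDeriv_le hs (x + (t : Circ)))
  rwa [sub_zero, abs_signedRep] at this

/-- The mean value of `|f|` is bounded by the `L²` norm, and its oscillation by the derivative. -/
theorem norm_apply_le (hs : 3 / 2 < s) (f : Hs s n) (x : Circ) :
    ‖f x‖ ≤ (1 + morreyConst (s - 1)) * ‖f‖ := by
  have hint : ∀ g : Circ → E n, Continuous g → Integrable (fun y => ‖g y‖) := fun g hg =>
    hg.norm.integrable_of_hasCompactSupport (HasCompactSupport.of_compactSpace _)
  have h0 : 0 ≤ morreyConst (s - 1) * ‖f‖ := (norm_nonneg _).trans (f.norm_circDeriv_le hs x)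
  have h1 : ∀ y, ‖f x‖ ≤ ‖f y‖ + morreyConst (s - 1) * ‖f‖ := by
    intro y
    have h2 := f.norm_sub_le hs y x
    have h3 : ‖x - y‖ ≤ 1 := (AddCircle.norm_le_half_period 1 one_ne_zero).trans (by norm_num)
    have h4 : ‖f x‖ ≤ ‖f y‖ + ‖f x - f y‖ := by
      simpa using norm_add_le (f y) (f x - f y)
    nlinarith
  have h2 : ‖f x‖ ≤ (∫ y, ‖f y‖) + morreyConst (s - 1) * ‖f‖ := by
    have := integral_mono (μ := (volume : Measure Circ)) (integrable_const _)
      ((hint f f.continuous).add (integrable_const _)) h1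
    simpa [integral_add (hint f f.continuous) (integrable_const _)] using this
  have h3 : ∫ y, ‖f y‖ ≤ ‖f‖ := by
    refine le_trans ?_ f.norm_toL2_le
    have hm := memLp_of_continuous f.continuous
    change _ ≤ ‖hm.toLp f.toFun‖
    rw [Lp.norm_toLp, integral_norm_eq_lintegral_enorm hm.1, ← eLpNorm_one_eq_lintegral_enorm]
    exact ENNReal.toReal_mono hm.2.ne (eLpNorm_le_eLpNorm_of_exponent_le one_le_two hm.1)
  linarith

end Hs

/-- An injective regular curve is bi-Lipschitz onto its image: near the diagonal by regularity, and
off the diagonal by injectivity and compactness. -/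
theorem exists_lower_bound {γ g : Circ → E n} (hγ : Continuous γ) (hg : Continuous g)
    (hd : ∀ t : ℝ, HasDerivAt (fun u : ℝ => γ (u : Circ)) (g (t : Circ)) t)
    (hinj : Function.Injective γ) (hreg : ∀ x, g x ≠ 0) :
    ∃ c > 0, (∀ x y, c * ‖y - x‖ ≤ ‖γ y - γ x‖) ∧ ∀ x, c ≤ ‖g x‖ := by
  have h1 : ∃ c > 0, ∀ p ∈ (univ : Set (Circ × Circ)), c * ‖p.2 - p.1‖ ≤ ‖γ p.2 - γ p.1‖ := by
    refine isCompact_univ.induction_on (p := fun S : Set (Circ × Circ) => ∃ c > 0, ∀ p ∈ S,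
      c * ‖p.2 - p.1‖ ≤ ‖γ p.2 - γ p.1‖) ⟨1, one_pos, by simp⟩ ?_ ?_ ?_
    · rintro S T hST ⟨c, hc, h⟩
      exact ⟨c, hc, fun p hp => h p (hST hp)⟩
    · rintro S T ⟨c, hc, h⟩ ⟨c', hc', h'⟩
      refine ⟨min c c', lt_min hc hc', ?_⟩
      rintro p (hp | hp)
      · exact (mul_le_mul_of_nonneg_right (min_le_left _ _) (norm_nonneg _)).trans (h p hp)
      · exact (mul_le_mul_of_nonneg_right (min_le_right _ _) (norm_nonneg _)).trans (h' p hp)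
    · rintro ⟨x, y⟩ -
      rw [nhdsWithin_univ]
      rcases eq_or_ne x y with rfl | hne
      · obtain ⟨t, rfl⟩ := QuotientAddGroup.mk_surjective x
        -- near the diagonal the increments are close to those of the tangent line
        have hst : HasStrictDerivAt (fun u : ℝ => γ (u : Circ)) (g (t : Circ)) t :=
          hasStrictDerivAt_of_hasDerivAt_of_continuousAt (Eventually.of_forall hd)
            (hg.comp coe_continuous).continuousAt
        have hpos : 0 < ‖g (t : Circ)‖ := norm_pos_iff.2 (hreg _)
        have hev := hst.isLittleO.def (half_pos hpos)
        have hmap : 𝓝 ((t : Circ), (t : Circ)) =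
            map (fun p : ℝ × ℝ => ((p.1 : Circ), (p.2 : Circ))) (𝓝 (t, t)) := by
          have e : 𝓝 (t : Circ) = map (fun u : ℝ => (u : Circ)) (𝓝 t) :=
            QuotientAddGroup.nhds_eq _ t
          rw [nhds_prod_eq, nhds_prod_eq, e]
          exact prod_map_map_eq
        refine ⟨_, ?_, ‖g (t : Circ)‖ / 2, half_pos hpos, fun p hp => hp⟩
        change ∀ᶠ p in 𝓝 ((t : Circ), (t : Circ)),
          ‖g (t : Circ)‖ / 2 * ‖p.2 - p.1‖ ≤ ‖γ p.2 - γ p.1‖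
        rw [hmap, eventually_map]
        filter_upwards [hev] with p hp
        simp only [ContinuousLinearMap.toSpanSingleton_apply] at hp
        have e1 : ‖(p.2 : Circ) - (p.1 : Circ)‖ ≤ ‖p.1 - p.2‖ := by
          rw [← AddCircle.coe_sub, norm_sub_rev]
          exact norm_coe_le _
        have e2 : ‖(p.1 - p.2) • g (t : Circ)‖ ≤
            ‖γ (p.1 : Circ) - γ (p.2 : Circ) - (p.1 - p.2) • g (t : Circ)‖ +
              ‖γ (p.1 : Circ) - γ (p.2 : Circ)‖ := by
          rw [← norm_neg (γ (p.1 : Circ) - γ (p.2 : Circ) - _)]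
          refine le_trans (le_of_eq ?_) (norm_add_le _ _)
          congr 1
          abel
        rw [norm_smul] at e2
        rw [norm_sub_rev (γ (p.2 : Circ))]
        nlinarith
      · have hpos : 0 < ‖γ y - γ x‖ := norm_pos_iff.2 (sub_ne_zero.2 fun h => hne (hinj h).symm)
        have hc : Continuous (fun p : Circ × Circ => ‖γ p.2 - γ p.1‖) := by fun_prop
        have hev := hc.continuousAt.eventually (lt_mem_nhds (half_lt_self hpos) :
          ∀ᶠ r in 𝓝 (‖γ ((x, y) : Circ × Circ).2 - γ ((x, y) : Circ × Circ).1‖),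
            ‖γ y - γ x‖ / 2 < r)
        refine ⟨_, hev, ‖γ y - γ x‖ / 2, half_pos hpos, fun p hp => ?_⟩
        have h3 : ‖p.2 - p.1‖ ≤ 1 :=
          (AddCircle.norm_le_half_period 1 one_ne_zero).trans (by norm_num)
        have hp' : ‖γ y - γ x‖ / 2 < ‖γ p.2 - γ p.1‖ := hp
        nlinarith [half_pos hpos]
  obtain ⟨c, hc, h⟩ := h1
  obtain ⟨x₀, -, hx₀⟩ := isCompact_univ.exists_isMinOn univ_nonempty hg.norm.continuousOn
  refine ⟨min c ‖g x₀‖, lt_min hc (norm_pos_iff.2 (hreg x₀)), fun x y => ?_, fun x => ?_⟩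
  · exact (mul_le_mul_of_nonneg_right (min_le_left _ _) (norm_nonneg _)).trans
      (h (x, y) (mem_univ _))
  · exact (min_le_right _ _).trans (isMinOn_iff.1 hx₀ x (mem_univ x))

theorem exists_lower_bound_of_mem_embeddings (hs : 3 / 2 < s) {γ : Hs s n}
    (hγ : γ ∈ embeddings s n) :
    ∃ c > 0, (∀ x y, c * ‖y - x‖ ≤ ‖γ y - γ x‖) ∧ ∀ x, c ≤ ‖circDeriv γ.toFun x‖ :=
  exists_lower_bound γ.continuous (γ.continuous_circDeriv hs) (γ.hasDerivAt hs) hγ.1 hγ.2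

theorem isOpen_embeddings (hs : 3 / 2 < s) : IsOpen (embeddings s n) := by
  rw [Metric.isOpen_iff]
  intro γ hγ
  obtain ⟨c, hc, h1, h2⟩ := exists_lower_bound_of_mem_embeddings hs hγ
  set M := morreyConst (s - 1) with hM
  have hM0 : 0 < |M| + 1 := by positivity
  refine ⟨c / 2 / (|M| + 1), by positivity, fun η hη => ?_⟩
  rw [Metric.mem_ball, dist_eq_norm] at hη
  have hlt : M * ‖η - γ‖ ≤ c / 2 := by
    rw [lt_div_iff₀ hM0] at hη
    nlinarith [le_abs_self M, norm_nonneg (η - γ)]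
  have hadd : η = γ + (η - γ) := by abel
  constructor
  · intro x y hxy
    by_contra hne
    have hpos : 0 < ‖y - x‖ := norm_pos_iff.2 (sub_ne_zero.2 (Ne.symm hne))
    have e1 := (η - γ).norm_sub_le hs x y
    have e2 : (η - γ) y - (η - γ) x = -(γ y - γ x) := by
      have : ∀ z, (η - γ) z = η z - γ z := fun z => rfl
      rw [this, this, hxy]
      abel
    rw [e2, norm_neg] at e1
    have e3 := h1 x y
    nlinarith
  · intro x hx
    have e1 := (η - γ).norm_circDeriv_le hs x
    rw [hadd, Hs.circDeriv_add hs, Pi.add_apply, add_eq_zero_iff_neg_eq] at hx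
    rw [← hx, norm_neg] at e1
    linarith [h2 x]

/-! ### Powers of bounded continuous functions -/

section Rpow

variable {X : Type*} [TopologicalSpace X]

/-- A bounded continuous function is uniformly positive if it has a positive lower bound. -/
def UniformlyPos (g : X →ᵇ ℝ) : Prop := ∃ c > 0, ∀ x, c ≤ g x

theorem UniformlyPos.pos {g : X →ᵇ ℝ} (h : UniformlyPos g) (x : X) : 0 < g x := by
  obtain ⟨c, hc, h⟩ := h
  exact hc.trans_le (h x)

theorem UniformlyPos.exists_rpow_bound {g : X →ᵇ ℝ} (h : UniformlyPos g) (a : ℝ) :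
    ∃ C, ∀ x, ‖g x ^ a‖ ≤ C := by
  obtain ⟨c, hc, h⟩ := h
  have h1 : ContinuousOn (fun r : ℝ => r ^ a) (Icc c ‖g‖) := fun r hr =>
    (Real.continuousAt_rpow_const r a (Or.inl (hc.trans_le hr.1).ne')).continuousWithinAt
  obtain ⟨C, hC⟩ := isCompact_Icc.exists_bound_of_continuousOn h1
  exact ⟨C, fun x => hC _ ⟨h x, (le_abs_self _).trans (g.norm_coe_le_norm x)⟩⟩

open Classical in
/-- The pointwise power `g ^ a` of a uniformly positive bounded continuous function, and `0` for
other functions. -/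
def bcfRpow (a : ℝ) (g : X →ᵇ ℝ) : X →ᵇ ℝ :=
  if h : UniformlyPos g then
    BoundedContinuousFunction.ofNormedAddCommGroup (fun x => g x ^ a)
      (g.continuous.rpow_const fun x => Or.inl (h.pos x).ne') _ (h.exists_rpow_bound a).choose_spec
  else 0

theorem bcfRpow_apply {g : X →ᵇ ℝ} (h : UniformlyPos g) (a : ℝ) (x : X) :
    bcfRpow a g x = g x ^ a := by
  rw [bcfRpow, dif_pos h]
  rfl

/-- The coefficients of the binomial series are the same in every Banach algebra, so that its
radius of convergence is at least the one over `ℝ`. -/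
theorem one_le_radius_binomialSeries_bcf (a : ℝ) : 1 ≤ (binomialSeries (X →ᵇ ℝ) a).radius := by
  refine (binomialSeries_radius_ge_one (𝕂 := ℝ) (𝔸 := ℝ) (a := a)).trans ?_
  have h : ∀ k : ℕ, 0 < k → ‖binomialSeries (X →ᵇ ℝ) a k‖ ≤ ‖binomialSeries ℝ a k‖ := by
    intro k hk
    unfold binomialSeries
    rw [FormalMultilinearSeries.ofScalars_norm (E := ℝ)]
    exact FormalMultilinearSeries.ofScalars_norm_le _ _ _ hk
  refine ENNReal.le_of_forall_nnreal_lt fun r hr => ?_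
  obtain ⟨C, hC, hb⟩ := FormalMultilinearSeries.norm_mul_pow_le_of_lt_radius _ hr
  refine FormalMultilinearSeries.le_radius_of_eventually_le _ C ?_
  filter_upwards [eventually_gt_atTop 0] with k hk
  exact (mul_le_mul_of_nonneg_right (h k hk) (by positivity)).trans (hb k)

theorem binomialSeries_sum_bcf_apply (a : ℝ) {u : X →ᵇ ℝ} (hu : ‖u‖ < 1) (x : X) :
    (binomialSeries (X →ᵇ ℝ) a).sum u x = (1 + u x) ^ a := by
  have h1 : u ∈ Metric.eball (0 : X →ᵇ ℝ) (binomialSeries (X →ᵇ ℝ) a).radius := by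
    refine Metric.eball_subset_eball (one_le_radius_binomialSeries_bcf a) ?_
    rw [Metric.mem_eball, edist_zero_right, ← ofReal_norm]
    exact ENNReal.ofReal_lt_one.2 hu
  have h2 := (FormalMultilinearSeries.hasSum _ h1).mapL (BoundedContinuousFunction.evalCLM ℝ x)
  have h3 : u x ∈ Metric.eball (0 : ℝ) 1 := by
    rw [Metric.mem_eball, edist_zero_right, ← ofReal_norm]
    exact ENNReal.ofReal_lt_one.2 ((u.norm_coe_le_norm x).trans_lt hu)
  have h4 := (Real.one_add_rpow_hasFPowerSeriesOnBall_zero (a := a)).hasSum h3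
  rw [zero_add] at h4
  refine h2.unique ?_
  have e : ∀ k, BoundedContinuousFunction.evalCLM ℝ x
      (binomialSeries (X →ᵇ ℝ) a k fun _ => u) = binomialSeries ℝ a k fun _ => u x := by
    intro k
    simp only [binomialSeries_apply, map_smul, List.ofFn_const, List.prod_replicate,
      BoundedContinuousFunction.evalCLM_apply, BoundedContinuousFunction.pow_apply]
  simpa only [e] using h4

/-- Powers are analytic on uniformly positive functions, by the binomial series
`g ^ a = g₀ ^ a * (1 + (g - g₀) / g₀) ^ a`. -/
theorem analyticAt_bcfRpow (a : ℝ) {g₀ : X →ᵇ ℝ} (h : UniformlyPos g₀) :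
    AnalyticAt ℝ (bcfRpow a) g₀ := by
  set P := binomialSeries (X →ᵇ ℝ) a with hP
  set v : X →ᵇ ℝ := bcfRpow (-1) g₀ with hv
  have hPa : AnalyticAt ℝ P.sum 0 := (P.hasFPowerSeriesOnBall
    (zero_lt_one.trans_le (one_le_radius_binomialSeries_bcf a))).analyticAt
  have h1 : AnalyticAt ℝ (fun g : X →ᵇ ℝ => v * (g - g₀)) g₀ :=
    analyticAt_const.mul (analyticAt_id.sub analyticAt_const)
  have h2 : AnalyticAt ℝ (fun g : X →ᵇ ℝ => bcfRpow a g₀ * P.sum (v * (g - g₀))) g₀ :=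
    analyticAt_const.mul (AnalyticAt.fun_comp (by simpa using hPa) h1)
  refine h2.congr ?_
  have h3 : ∀ᶠ g in 𝓝 g₀, ‖v * (g - g₀)‖ < 1 := by
    have := h1.continuousAt.norm
    exact this.eventually (gt_mem_nhds (by simp))
  obtain ⟨c, hc, hg₀⟩ := id h
  have h4 : ∀ᶠ g in 𝓝 g₀, UniformlyPos g := by
    filter_upwards [Metric.ball_mem_nhds g₀ (half_pos hc)] with g hg
    refine ⟨c / 2, half_pos hc, fun x => ?_⟩
    have h5 := (BoundedContinuousFunction.dist_coe_le_dist x).trans_lt (Metric.mem_ball.1 hg)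
    rw [Real.dist_eq, abs_lt] at h5
    linarith [hg₀ x]
  filter_upwards [h3, h4] with g hg3 hg4
  ext x
  have hp := h.pos x
  have hsm : |(v * (g - g₀)) x| < 1 := ((v * (g - g₀)).norm_coe_le_norm x).trans_lt hg3
  have e : g₀ x * (1 + (v * (g - g₀)) x) = g x := by
    simp only [BoundedContinuousFunction.mul_apply, BoundedContinuousFunction.sub_apply, hv,
      bcfRpow_apply h, Real.rpow_neg_one]
    field_simp
    ring
  rw [BoundedContinuousFunction.mul_apply, binomialSeries_sum_bcf_apply a hg3,
    bcfRpow_apply h, bcfRpow_apply hg4, ← Real.mul_rpow hp.le (by linarith [(abs_lt.1 hsm).1]), e]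

end Rpow

/-! ### Functions on pairs of distinct points, and bilinear forms given by integrals -/

/-- The pairs of distinct points of the circle. -/
abbrev OffDiag : Type := {p : Circ × Circ // p.1 ≠ p.2}

/-- Lebesgue measure on the pairs of distinct points of the circle. -/
def offVol : Measure OffDiag := Measure.comap Subtype.val volume

theorem measurableSet_offDiag : MeasurableSet {p : Circ × Circ | p.1 ≠ p.2} :=
  (measurableSet_eq_fun measurable_fst measurable_snd).compl

theorem measurableEmbedding_offDiag : MeasurableEmbedding (Subtype.val : OffDiag → Circ × Circ) :=
  MeasurableEmbedding.subtype_coe measurableSet_offDiag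

theorem volume_diagonal_circ : volume {p : Circ × Circ | p.1 = p.2} = 0 := by
  rw [Measure.volume_eq_prod,
    Measure.measure_prod_null (measurableSet_eq_fun measurable_fst measurable_snd)]
  refine ae_of_all _ fun x => ?_
  have e : Prod.mk x ⁻¹' {p : Circ × Circ | p.1 = p.2} = Metric.closedBall x 0 := by
    ext y
    simp [eq_comm]
  change volume (Prod.mk x ⁻¹' {p : Circ × Circ | p.1 = p.2}) = 0
  rw [e, AddCircle.volume_closedBall]
  simp

/-- The diagonal is a null set. -/
theorem measurePreserving_offDiag :
    MeasurePreserving (Subtype.val : OffDiag → Circ × Circ) offVol volume := by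
  refine ⟨measurable_subtype_coe, ?_⟩
  rw [offVol, measurableEmbedding_offDiag.map_comap]
  refine Measure.restrict_eq_self_of_ae_mem ?_
  have h : ∀ᵐ p : Circ × Circ, ¬ p.1 = p.2 := by
    rw [ae_iff]
    simpa using volume_diagonal_circ
  filter_upwards [h] with p hp using ⟨⟨p, hp⟩, rfl⟩

instance : IsFiniteMeasure offVol := by
  constructor
  have := measurePreserving_offDiag.measure_preimage (s := univ)
    MeasurableSet.univ.nullMeasurableSet
  rw [preimage_univ] at this
  rw [this]
  exact measure_lt_top _ _

namespace Hs

/-- A linear family of continuous functions on the pairs of distinct points, bounded by the norm of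
`H^s`, as a continuous linear map. -/
def mkBCF (Φ : Hs s n → OffDiag → E n) (hc : ∀ h, Continuous (Φ h))
    (hadd : ∀ h k p, Φ (h + k) p = Φ h p + Φ k p) (hsmul : ∀ (c : ℝ) h p, Φ (c • h) p = c • Φ h p)
    (C : ℝ) (hC : ∀ h p, ‖Φ h p‖ ≤ C * ‖h‖) : Hs s n →L[ℝ] (OffDiag →ᵇ E n) :=
  LinearMap.mkContinuous
    { toFun := fun h => BoundedContinuousFunction.ofNormedAddCommGroup (Φ h) (hc h) _ (hC h)
      map_add' := fun h k => by ext1 p; exact hadd h k p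
      map_smul' := fun c h => by ext1 p; exact hsmul c h p } (|C|) fun h => by
    refine (BoundedContinuousFunction.norm_le (by positivity)).2 fun p => (hC h p).trans ?_
    exact mul_le_mul_of_nonneg_right (le_abs_self C) (norm_nonneg h)

variable (hs : 3 / 2 < s)

/-- The map `h ↦ ((x, y) ↦ h(x))`. -/
def evalFst : Hs s n →L[ℝ] (OffDiag →ᵇ E n) :=
  mkBCF (fun h p => h p.1.1)
    (fun h => h.continuous.comp (continuous_fst.comp continuous_subtype_val))
    (fun _ _ _ => rfl) (fun _ _ _ => rfl) _ (fun h p => h.norm_apply_le hs p.1.1)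

/-- The map `h ↦ ((x, y) ↦ h'(x))`. -/
def derivFst : Hs s n →L[ℝ] (OffDiag →ᵇ E n) :=
  mkBCF (fun h p => circDeriv h.toFun p.1.1)
    (fun h => (h.continuous_circDeriv hs).comp (continuous_fst.comp continuous_subtype_val))
    (fun h k p => by rw [circDeriv_add hs]; rfl) (fun c h p => by rw [circDeriv_smul hs]; rfl)
    _ (fun h p => h.norm_circDeriv_le hs p.1.1)

/-- The map `h ↦ ((x, y) ↦ h'(y))`. -/
def derivSnd : Hs s n →L[ℝ] (OffDiag →ᵇ E n) :=
  mkBCF (fun h p => circDeriv h.toFun p.1.2)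
    (fun h => (h.continuous_circDeriv hs).comp (continuous_snd.comp continuous_subtype_val))
    (fun h k p => by rw [circDeriv_add hs]; rfl) (fun c h p => by rw [circDeriv_smul hs]; rfl)
    _ (fun h p => h.norm_circDeriv_le hs p.1.2)

theorem _root_.KnotMetric.OffDiag.norm_pos (p : OffDiag) : 0 < ‖p.1.2 - p.1.1‖ :=
  norm_pos_iff.2 (sub_ne_zero.2 p.2.symm)

/-- The map `h ↦ ((x, y) ↦ (h(y) - h(x)) / |y - x|)`. -/
def diffQuot : Hs s n →L[ℝ] (OffDiag →ᵇ E n) :=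
  mkBCF (fun h p => ‖p.1.2 - p.1.1‖⁻¹ • (h p.1.2 - h p.1.1))
    (fun h => by
      have h1 := h.continuous
      have h2 : Continuous fun p : OffDiag => ‖p.1.2 - p.1.1‖ := by fun_prop
      have h3 : Continuous fun p : OffDiag => ‖p.1.2 - p.1.1‖⁻¹ := h2.inv₀ fun p => p.norm_pos.ne'
      fun_prop)
    (fun h k p => by
      rw [toFun_add, ← smul_add]
      simp only [Pi.add_apply]
      congr 1
      abel)
    (fun c h p => by
      rw [toFun_smul, smul_comm c]
      simp only [Pi.smul_apply, smul_sub])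
    _ (fun h p => by
      rw [norm_smul, norm_inv, norm_norm, inv_mul_le_iff₀ p.norm_pos, mul_comm]
      exact h.norm_sub_le hs p.1.1 p.1.2)

theorem derivFst_apply (h : Hs s n) (p : OffDiag) :
    derivFst hs h p = circDeriv h.toFun p.1.1 := rfl

theorem derivSnd_apply (h : Hs s n) (p : OffDiag) :
    derivSnd hs h p = circDeriv h.toFun p.1.2 := rfl

theorem diffQuot_apply (h : Hs s n) (p : OffDiag) :
    diffQuot hs h p = ‖p.1.2 - p.1.1‖⁻¹ • (h p.1.2 - h p.1.1) := rfl

include hs in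
theorem eLpNorm_taylorQuot_lt_top_and_le (h : Hs s n) :
    eLpNorm (taylorQuot s h.toFun (circDeriv h.toFun)) 2 volume < ∞ ∧
    (eLpNorm (taylorQuot s h.toFun (circDeriv h.toFun)) 2 volume).toReal ≤ ‖h‖ := by
  have h1 := eLpNorm_taylorQuot_le (by linarith : 1 ≤ s) h.continuous (h.continuous_circDeriv hs)
    (h.hasDerivAt hs)
  rw [← eLpNorm_congr_ae (quot_congr (h.weakDeriv_ae_eq hs))] at h1
  have h2 := h.isSobolevDeriv.quot_memLp.2
  exact ⟨h1.trans_lt h2, (ENNReal.toReal_mono h2.ne h1).trans h.toReal_eLpNorm_quot_le⟩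

include hs in
theorem memLp_taylorQuot (h : Hs s n) :
    MemLp (fun p : OffDiag => taylorQuot s h.toFun (circDeriv h.toFun) p.1) 2 offVol := by
  have hm : MemLp (taylorQuot s h.toFun (circDeriv h.toFun)) 2 volume :=
    ⟨(measurable_taylorQuot h.continuous (h.continuous_circDeriv hs) s).aestronglyMeasurable,
      (h.eLpNorm_taylorQuot_lt_top_and_le hs).1⟩
  exact hm.comp_measurePreserving measurePreserving_offDiag

/-- The map `h ↦ (h(y) - h(x) - (y - x) h'(x)) / |y - x|^(s + 1/2)` from `H^s` to `L²`. -/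
def taylorL2 : Hs s n →L[ℝ] Lp (E n) 2 offVol :=
  LinearMap.mkContinuous
    { toFun := fun h => (h.memLp_taylorQuot hs).toLp _
      map_add' := fun h k => by
        rw [← MemLp.toLp_add]
        refine MemLp.toLp_congr _ _ (ae_of_all _ fun p => ?_)
        rw [circDeriv_add hs]
        simp only [taylorQuot, toFun_add, Pi.add_apply, ← smul_add]
        congr 1
        module
      map_smul' := fun c h => by
        rw [RingHom.id_apply, ← MemLp.toLp_const_smul]
        refine MemLp.toLp_congr _ _ (ae_of_all _ fun p => ?_)
        rw [circDeriv_smul hs]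
        simp only [taylorQuot, toFun_smul, Pi.smul_apply]
        module } 1 fun h => by
    rw [one_mul]
    change ‖(h.memLp_taylorQuot hs).toLp _‖ ≤ ‖h‖
    rw [Lp.norm_toLp]
    refine le_of_eq_of_le (congrArg ENNReal.toReal ?_) (h.eLpNorm_taylorQuot_lt_top_and_le hs).2
    exact eLpNorm_comp_measurePreserving
      (measurable_taylorQuot h.continuous (h.continuous_circDeriv hs) s).aestronglyMeasurable
      measurePreserving_offDiag

theorem coeFn_taylorL2 (h : Hs s n) :
    taylorL2 hs h =ᵐ[offVol] fun p => taylorQuot s h.toFun (circDeriv h.toFun) p.1 :=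
  MemLp.coeFn_toLp (h.memLp_taylorQuot hs)

end Hs

section Pairings

/-- Composition of operators that depend analytically on a parameter is analytic. -/
theorem analyticAt_clm_comp {V X Y Z : Type*} [NormedAddCommGroup V] [NormedSpace ℝ V]
    [NormedAddCommGroup X] [NormedSpace ℝ X] [NormedAddCommGroup Y] [NormedSpace ℝ Y]
    [NormedAddCommGroup Z] [NormedSpace ℝ Z] {S : V → Y →L[ℝ] Z} {T : V → X →L[ℝ] Y} {v : V}
    (hS : AnalyticAt ℝ S v) (hT : AnalyticAt ℝ T v) : AnalyticAt ℝ (fun v => S v ∘L T v) v :=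
  AnalyticAt.fun_comp (f := fun v => (S v, T v))
    ((ContinuousLinearMap.compL ℝ X Y Z).analyticAt_bilinear (S v, T v)) (hS.prod hT)

theorem analyticAt_clm_apply {V X Y : Type*} [NormedAddCommGroup V] [NormedSpace ℝ V]
    [NormedAddCommGroup X] [NormedSpace ℝ X] [NormedAddCommGroup Y] [NormedSpace ℝ Y]
    {S : V → X →L[ℝ] Y} {x : V → X} {v : V}
    (hS : AnalyticAt ℝ S v) (hx : AnalyticAt ℝ x v) : AnalyticAt ℝ (fun v => S v (x v)) v :=
  AnalyticAt.fun_comp (f := fun v => (S v, x v))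
    ((ContinuousLinearMap.id ℝ (X →L[ℝ] Y)).analyticAt_bilinear (S v, x v)) (hS.prod hx)

theorem analyticAt_clm_const {V X Y : Type*} [NormedAddCommGroup V] [NormedSpace ℝ V]
    [NormedAddCommGroup X] [NormedSpace ℝ X] [NormedAddCommGroup Y] [NormedSpace ℝ Y]
    (S : X →L[ℝ] Y) {x : V → X} {v : V} (hx : AnalyticAt ℝ x v) :
    AnalyticAt ℝ (fun v => S (x v)) v :=
  (S.analyticAt (x v)).fun_comp hx

/-- The class in `L^∞` of a bounded continuous function. -/
abbrev toLinf {F : Type*} [NormedAddCommGroup F] [NormedSpace ℝ F] [SecondCountableTopology F] :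
    (OffDiag →ᵇ F) →L[ℝ] Lp F ∞ offVol := BoundedContinuousFunction.toLp ∞ offVol ℝ

/-- The class in `L¹` of a bounded continuous function. -/
abbrev toL1 : (OffDiag →ᵇ ℝ) →L[ℝ] Lp ℝ 1 offVol := BoundedContinuousFunction.toLp 1 offVol ℝ

/-- The inner product of `ℝⁿ` as a continuous bilinear map. -/
def innerE (n : ℕ) : E n →L[ℝ] E n →L[ℝ] ℝ := innerSL ℝ

theorem innerE_apply (v w : E n) : innerE n v w = inner ℝ v w := rfl

/-- Scalar multiplication on `ℝⁿ` as a continuous bilinear map. -/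
def smulE (n : ℕ) : ℝ →L[ℝ] E n →L[ℝ] E n := ContinuousLinearMap.lsmul ℝ ℝ

theorem smulE_apply (c : ℝ) (v : E n) : smulE n c v = c • v := rfl

/-- The function `|g|²` for a bounded continuous function `g`. -/
def bcfNormSq (g : OffDiag →ᵇ E n) : OffDiag →ᵇ ℝ :=
  ∑ i, ContinuousLinearMap.compLeftContinuousBounded OffDiag
    (EuclideanSpace.proj i : E n →L[ℝ] ℝ) g ^ 2

theorem bcfNormSq_apply (g : OffDiag →ᵇ E n) (p : OffDiag) : bcfNormSq g p = ‖g p‖ ^ 2 := by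
  rw [bcfNormSq, EuclideanSpace.real_norm_sq_eq, BoundedContinuousFunction.sum_apply]
  rfl

theorem analyticAt_bcfNormSq (P : Hs s n →L[ℝ] (OffDiag →ᵇ E n)) (γ : Hs s n) :
    AnalyticAt ℝ (fun γ => bcfNormSq (P γ)) γ := by
  unfold bcfNormSq
  refine Finset.analyticAt_fun_sum _ fun i _ => AnalyticAt.fun_pow ?_ 2
  exact ((ContinuousLinearMap.compLeftContinuousBounded OffDiag
    (EuclideanSpace.proj i : E n →L[ℝ] ℝ)).comp P).analyticAt γ

/-- The bilinear form `(h, k) ↦ ∫ f ⟨P h, R k⟩` for an integrable weight `f` and operators `P`, `R`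
into bounded functions. -/
def weightedForm (f : Lp ℝ 1 offVol) (P R : Hs s n →L[ℝ] (OffDiag →ᵇ E n)) :
    Hs s n →L[ℝ] Hs s n →L[ℝ] ℝ :=
  ContinuousLinearMap.compL ℝ (Hs s n) (Lp ℝ ∞ offVol) ℝ
    ((ContinuousLinearMap.mul ℝ ℝ).lpPairing offVol 1 ∞ f) ∘L
    ((innerE n).holderL offVol ∞ ∞ ∞).bilinearComp (toLinf ∘L P) (toLinf ∘L R)

theorem analyticAt_weightedForm {f : Hs s n → Lp ℝ 1 offVol} {γ : Hs s n} (hf : AnalyticAt ℝ f γ)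
    (P R : Hs s n →L[ℝ] (OffDiag →ᵇ E n)) :
    AnalyticAt ℝ (fun γ => weightedForm (f γ) P R) γ := by
  let K := ((innerE n).holderL offVol ∞ ∞ ∞).bilinearComp (toLinf ∘L P) (toLinf ∘L R)
  let Λ : Lp ℝ 1 offVol →L[ℝ] Hs s n →L[ℝ] Hs s n →L[ℝ] ℝ :=
    (ContinuousLinearMap.compL ℝ (Hs s n) (Hs s n →L[ℝ] Lp ℝ ∞ offVol)
    (Hs s n →L[ℝ] ℝ)).flip K ∘L ContinuousLinearMap.compL ℝ (Hs s n) (Lp ℝ ∞ offVol) ℝ ∘L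
      (ContinuousLinearMap.mul ℝ ℝ).lpPairing offVol 1 ∞
  exact analyticAt_clm_const (Y := Hs s n →L[ℝ] Hs s n →L[ℝ] ℝ) Λ hf

/-- The defining integral of `weightedForm`, for any representative of the weight. -/
theorem weightedForm_integrand (f : Lp ℝ 1 offVol) (P R : Hs s n →L[ℝ] (OffDiag →ᵇ E n))
    (h k : Hs s n) {F : OffDiag → ℝ} (hF : f =ᵐ[offVol] F) :
    Integrable (fun p => F p * inner ℝ (P h p) (R k p)) offVol ∧
      weightedForm f P R h k = ∫ p, F p * inner ℝ (P h p) (R k p) ∂offVol := by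
  let K : Lp ℝ ∞ offVol := (innerE n).holder ∞ (toLinf (P h)) (toLinf (R k))
  have e1 : K =ᵐ[offVol] fun p => inner ℝ (P h p) (R k p) := by
    have h1 := (innerE n).coeFn_holder (r := ∞) (toLinf (P h)) (toLinf (R k))
    filter_upwards [h1, BoundedContinuousFunction.coeFn_toLp ∞ offVol ℝ (P h),
      BoundedContinuousFunction.coeFn_toLp ∞ offVol ℝ (R k)] with p h2 h3 h4
    rw [h2, h3, h4, innerE_apply]
  have e2 : (fun p => f p * K p) =ᵐ[offVol] fun p => F p * inner ℝ (P h p) (R k p) := by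
    filter_upwards [e1, hF] with p h1 h2
    rw [h1, h2]
  constructor
  · refine Integrable.congr ?_ e2
    have := (ContinuousLinearMap.mul ℝ ℝ).memLp_of_bilin 1 (Lp.memLp f) (Lp.memLp K)
    exact memLp_one_iff_integrable.1 this
  · rw [← integral_congr_ae e2]
    exact (ContinuousLinearMap.mul ℝ ℝ).lpPairing_eq_integral f K

/-- The bilinear form `(h, k) ↦ ∫ w ⟨A h, A k⟩` for a bounded weight `w` and an operator `A` into
`L²`. -/
def weightedL2Form (w : OffDiag →ᵇ ℝ) (A : Hs s n →L[ℝ] Lp (E n) 2 offVol) :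
    Hs s n →L[ℝ] Hs s n →L[ℝ] ℝ :=
  (ContinuousLinearMap.compL ℝ (Hs s n) (Lp (E n) 2 offVol) ℝ).flip A ∘L
    (innerE n).lpPairing offVol 2 2 ∘L (smulE n).holderL offVol ∞ 2 2 (toLinf w) ∘L A

theorem analyticAt_weightedL2Form {w : Hs s n → OffDiag →ᵇ ℝ}
    {A : Hs s n → Hs s n →L[ℝ] Lp (E n) 2 offVol} {γ : Hs s n} (hw : AnalyticAt ℝ w γ)
    (hA : AnalyticAt ℝ A γ) : AnalyticAt ℝ (fun γ => weightedL2Form (w γ) (A γ)) γ := by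
  have h1 : AnalyticAt ℝ (fun γ =>
      (ContinuousLinearMap.compL ℝ (Hs s n) (Lp (E n) 2 offVol) ℝ).flip (A γ)) γ :=
    analyticAt_clm_const _ hA
  have h2 : AnalyticAt ℝ (fun γ => (smulE n).holderL offVol ∞ 2 2 (toLinf (w γ))) γ :=
    analyticAt_clm_const ((smulE n).holderL offVol ∞ 2 2 ∘L toLinf) hw
  exact analyticAt_clm_comp h1 (analyticAt_clm_comp analyticAt_const (analyticAt_clm_comp h2 hA))

/-- The defining integral of `weightedL2Form`, for any representatives of `A h` and `A k`. -/
theorem weightedL2Form_integrand (w : OffDiag →ᵇ ℝ) (A : Hs s n →L[ℝ] Lp (E n) 2 offVol)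
    (h k : Hs s n) {F H : OffDiag → E n} (hF : A h =ᵐ[offVol] F) (hH : A k =ᵐ[offVol] H) :
    Integrable (fun p => w p * inner ℝ (F p) (H p)) offVol ∧
      weightedL2Form w A h k = ∫ p, w p * inner ℝ (F p) (H p) ∂offVol := by
  let K : Lp (E n) 2 offVol := (smulE n).holder 2 (toLinf w) (A h)
  have e1 : K =ᵐ[offVol] fun p => w p • F p := by
    have h1 := (smulE n).coeFn_holder (r := 2) (toLinf w) (A h)
    filter_upwards [h1, BoundedContinuousFunction.coeFn_toLp ∞ offVol ℝ w, hF] with p h2 h3 h4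
    rw [h2, h3, h4, smulE_apply]
  have e2 : (fun p => innerE n (K p) (A k p)) =ᵐ[offVol] fun p => w p * inner ℝ (F p) (H p) := by
    filter_upwards [e1, hH] with p h1 h2
    rw [h1, h2, innerE_apply, real_inner_smul_left]
  constructor
  · refine Integrable.congr ?_ e2
    have := (innerE n).memLp_of_bilin 1 (Lp.memLp K) (Lp.memLp (A k))
    exact memLp_one_iff_integrable.1 this
  · rw [← integral_congr_ae e2]
    exact (innerE n).lpPairing_eq_integral K (A k)

end Pairings

/-! ### The metric as a bounded bilinear form -/

/-- The function `R^s_γ h` up to a scalar factor: the Taylor remainder of `h` minus the multiple of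
`h'(x)` that makes the expression for `h = γ` normal to `γ'(x)`. -/
def normalQuot (s : ℝ) (γ h : Circ → E n) (p : Circ × Circ) : E n :=
  taylorQuot s h (circDeriv h) p -
    ((‖circDeriv γ p.1‖ ^ 2)⁻¹ * inner ℝ (circDeriv γ p.1) (taylorQuot s γ (circDeriv γ) p)) •
      circDeriv h p.1

/-- The scalar factor between `R^s_γ h` and `normalQuot s γ h`. -/
def opFactor (s : ℝ) (γ : Circ → E n) (p : Circ × Circ) : ℝ :=
  (‖γ p.2 - γ p.1‖ ^ s)⁻¹ * ‖p.2 - p.1‖ ^ (s + 1 / 2)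

/-- Replacing the increments by their Taylor remainders does not change `R^s_γ h`, since the linear
parts cancel. -/
theorem op_eq_smul_normalQuot {γ h : Circ → E n} {p : Circ × Circ} (hp : p.1 ≠ p.2)
    (hreg : circDeriv γ p.1 ≠ 0) : op s γ h p = opFactor s γ p • normalQuot s γ h p := by
  have hd : 0 < ‖p.2 - p.1‖ ^ (s + 1 / 2) :=
    Real.rpow_pos_of_pos (norm_pos_iff.2 (sub_ne_zero.2 hp.symm)) _
  have hr : ‖circDeriv γ p.1‖ ≠ 0 := norm_ne_zero_iff.2 hreg
  have e : ∀ f : Circ → E n, f p.2 - f p.1 = ‖p.2 - p.1‖ ^ (s + 1 / 2) •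
      taylorQuot s f (circDeriv f) p + signedRep (p.2 - p.1) • circDeriv f p.1 := by
    intro f
    rw [taylorQuot, smul_smul, mul_inv_cancel₀ hd.ne', one_smul, sub_add_cancel]
  unfold op opFactor normalQuot
  rw [mul_smul]
  congr 1
  rw [e h, e γ]
  unfold arcDeriv
  simp only [inner_add_right, real_inner_smul_left, real_inner_smul_right,
    real_inner_self_eq_norm_sq]
  rw [smul_sub, smul_smul, smul_smul]
  generalize inner ℝ (circDeriv γ p.1) (taylorQuot s γ (circDeriv γ) p) = I
  have e2 : (‖p.2 - p.1‖ ^ (s + 1 / 2) * (‖circDeriv γ p.1‖⁻¹ * I) + signedRep (p.2 - p.1) *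
      (‖circDeriv γ p.1‖⁻¹ * ‖circDeriv γ p.1‖ ^ 2)) * ‖circDeriv γ p.1‖⁻¹ =
      ‖p.2 - p.1‖ ^ (s + 1 / 2) * ((‖circDeriv γ p.1‖ ^ 2)⁻¹ * I) + signedRep (p.2 - p.1) := by
    field_simp
  rw [e2]
  module

/-- The powers of `|y - x|` in `opFactor` and `weight` combine with those of `|γ(y) - γ(x)|` to a
power of the chord-arc quotient, which is bounded and bounded below. -/
theorem opFactor_sq_mul_weight {γ : Circ → E n} {p : Circ × Circ} (hp : p.1 ≠ p.2)
    (hinj : γ p.1 ≠ γ p.2) :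
    opFactor s γ p ^ 2 * weight γ p =
      (‖circDeriv γ p.1‖ ^ 2) ^ (1 / 2 : ℝ) * (‖circDeriv γ p.2‖ ^ 2) ^ (1 / 2 : ℝ) *
        (‖‖p.2 - p.1‖⁻¹ • (γ p.2 - γ p.1)‖ ^ 2) ^ (-(s + 1 / 2)) := by
  have hd : 0 < ‖p.2 - p.1‖ := norm_pos_iff.2 (sub_ne_zero.2 hp.symm)
  have hD : 0 < ‖γ p.2 - γ p.1‖ := norm_pos_iff.2 (sub_ne_zero.2 hinj.symm)
  have hroot : ∀ r : ℝ, 0 ≤ r → (r ^ 2) ^ (1 / 2 : ℝ) = r := fun r hr => by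
    rw [← Real.sqrt_eq_rpow, Real.sqrt_sq hr]
  rw [hroot _ (norm_nonneg _), hroot _ (norm_nonneg _), norm_smul, norm_inv, norm_norm]
  unfold opFactor weight
  set d := ‖p.2 - p.1‖
  set D := ‖γ p.2 - γ p.1‖
  have e1 : ((d⁻¹ * D) ^ 2) ^ (-(s + 1 / 2)) = (d ^ (s + 1 / 2)) ^ 2 * ((D ^ s) ^ 2 * D)⁻¹ := by
    rw [← Real.rpow_natCast, ← Real.rpow_mul (by positivity), Real.mul_rpow (by positivity) hD.le,
      Real.inv_rpow hd.le, ← Real.rpow_neg hd.le, ← Real.rpow_mul_natCast hd.le,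
      ← Real.rpow_mul_natCast hD.le, ← Real.rpow_add_one hD.ne', ← Real.rpow_neg hD.le]
    congr 2 <;> push_cast <;> ring
  rw [e1]
  field_simp

namespace Hs

variable (hs : 3 / 2 < s)

/-- The function `|γ'(x)|²`. -/
def speedSqFst (γ : Hs s n) : OffDiag →ᵇ ℝ := bcfNormSq (derivFst hs γ)

/-- The function `|γ'(y)|²`. -/
def speedSqSnd (γ : Hs s n) : OffDiag →ᵇ ℝ := bcfNormSq (derivSnd hs γ)

/-- The function `|γ(y) - γ(x)|² / |y - x|²`. -/
def chordSq (γ : Hs s n) : OffDiag →ᵇ ℝ := bcfNormSq (diffQuot hs γ)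

/-- The density `|γ'(x)| |γ'(y)| (|γ(y) - γ(x)| / |y - x|)^(-(2s + 1))`. -/
def density (γ : Hs s n) : OffDiag →ᵇ ℝ :=
  bcfRpow (1 / 2) (speedSqFst hs γ) * bcfRpow (1 / 2) (speedSqSnd hs γ) *
    bcfRpow (-(s + 1 / 2)) (chordSq hs γ)

/-- The coefficient of the tangential correction in `normalQuot`, as a class in `L²`. -/
def tangentCoeff (γ : Hs s n) : Lp ℝ 2 offVol :=
  (ContinuousLinearMap.mul ℝ ℝ).holderL offVol ∞ 2 2 (toLinf (bcfRpow (-1) (speedSqFst hs γ)))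
    ((innerE n).holderL offVol ∞ 2 2 (toLinf (derivFst hs γ)) (taylorL2 hs γ))

/-- The operator `h ↦ normalQuot s γ h` from `H^s` to `L²`. -/
def normalL2 (γ : Hs s n) : Hs s n →L[ℝ] Lp (E n) 2 offVol :=
  taylorL2 hs - (smulE n).holderL offVol 2 ∞ 2 (tangentCoeff hs γ) ∘L (toLinf ∘L derivFst hs)

/-- The class of `|normalQuot s γ γ|²` in `L¹`. -/
def normalSq (γ : Hs s n) : Lp ℝ 1 offVol :=
  (innerE n).holderL offVol 2 2 1 (normalL2 hs γ γ) (normalL2 hs γ γ)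

/-- The class in `L¹` of `|normalQuot s γ γ|²` times a bounded weight. -/
def weightedNormalSq (w : OffDiag →ᵇ ℝ) (γ : Hs s n) : Lp ℝ 1 offVol :=
  (ContinuousLinearMap.mul ℝ ℝ).holderL offVol ∞ 1 1 (toLinf w) (normalSq hs γ)

/-- The metric as a bounded bilinear form, in the order of the terms of `metric`. The pointwise
powers have their intended values only if `γ` is embedded; otherwise some of them are replaced by `0`. -/
def metricForm (γ : Hs s n) : Hs s n →L[ℝ] Hs s n →L[ℝ] ℝ :=
  weightedForm (toL1 (bcfRpow (1 / 2) (speedSqFst hs γ))) (evalFst hs) (evalFst hs) +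
    weightedForm (toL1 (bcfRpow (-(1 / 2)) (speedSqFst hs γ))) (derivFst hs) (derivFst hs) +
    weightedL2Form (density hs γ) (normalL2 hs γ) +
    weightedForm (weightedNormalSq hs (density hs γ * bcfRpow (-1) (chordSq hs γ)) γ)
      (diffQuot hs) (diffQuot hs) +
    (weightedForm (weightedNormalSq hs (density hs γ * bcfRpow (-1) (speedSqFst hs γ)) γ)
        (derivFst hs) (derivFst hs) +
      weightedForm (weightedNormalSq hs (density hs γ * bcfRpow (-1) (speedSqSnd hs γ)) γ)
        (derivSnd hs) (derivSnd hs))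

/-! ### Analyticity of the metric -/

/-- The three positive functions from which all weights of the metric are built are uniformly
positive for embedded curves. -/
theorem uniformlyPos_of_mem_embeddings {γ : Hs s n} (hγ : γ ∈ embeddings s n) :
    UniformlyPos (speedSqFst hs γ) ∧ UniformlyPos (speedSqSnd hs γ) ∧
      UniformlyPos (chordSq hs γ) := by
  obtain ⟨c, hc, h1, h2⟩ := exists_lower_bound_of_mem_embeddings hs hγ
  refine ⟨⟨c ^ 2, by positivity, fun p => ?_⟩, ⟨c ^ 2, by positivity, fun p => ?_⟩,
    ⟨c ^ 2, by positivity, fun p => ?_⟩⟩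
  · rw [speedSqFst, bcfNormSq_apply, derivFst_apply]
    exact pow_le_pow_left₀ hc.le (h2 _) 2
  · rw [speedSqSnd, bcfNormSq_apply, derivSnd_apply]
    exact pow_le_pow_left₀ hc.le (h2 _) 2
  · rw [chordSq, bcfNormSq_apply, diffQuot_apply, norm_smul, norm_inv, norm_norm]
    refine pow_le_pow_left₀ hc.le ?_ 2
    rw [inv_mul_eq_div, le_div_iff₀ p.norm_pos]
    exact h1 _ _

section Analytic

variable {γ : Hs s n} (hγ : γ ∈ embeddings s n)
include hγ

theorem analyticAt_bcfRpow_speedSqFst (a : ℝ) :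
    AnalyticAt ℝ (fun γ => bcfRpow a (speedSqFst hs γ)) γ :=
  (analyticAt_bcfRpow a (uniformlyPos_of_mem_embeddings hs hγ).1).fun_comp
    (analyticAt_bcfNormSq _ γ)

theorem analyticAt_bcfRpow_speedSqSnd (a : ℝ) :
    AnalyticAt ℝ (fun γ => bcfRpow a (speedSqSnd hs γ)) γ :=
  (analyticAt_bcfRpow a (uniformlyPos_of_mem_embeddings hs hγ).2.1).fun_comp
    (analyticAt_bcfNormSq _ γ)

theorem analyticAt_bcfRpow_chordSq (a : ℝ) :
    AnalyticAt ℝ (fun γ => bcfRpow a (chordSq hs γ)) γ :=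
  (analyticAt_bcfRpow a (uniformlyPos_of_mem_embeddings hs hγ).2.2).fun_comp
    (analyticAt_bcfNormSq _ γ)

theorem analyticAt_density : AnalyticAt ℝ (density hs) γ :=
  ((analyticAt_bcfRpow_speedSqFst hs hγ _).mul (analyticAt_bcfRpow_speedSqSnd hs hγ _)).mul
    (analyticAt_bcfRpow_chordSq hs hγ _)

theorem analyticAt_tangentCoeff : AnalyticAt ℝ (tangentCoeff hs) γ := by
  have h1 : AnalyticAt ℝ (fun γ => (innerE n).holderL offVol ∞ 2 2 (toLinf (derivFst hs γ))) γ :=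
    ((innerE n).holderL offVol ∞ 2 2 ∘L toLinf ∘L derivFst hs).analyticAt γ
  have h2 : AnalyticAt ℝ (fun γ => (ContinuousLinearMap.mul ℝ ℝ).holderL offVol ∞ 2 2
      (toLinf (bcfRpow (-1) (speedSqFst hs γ)))) γ :=
    analyticAt_clm_const ((ContinuousLinearMap.mul ℝ ℝ).holderL offVol ∞ 2 2 ∘L toLinf)
      (analyticAt_bcfRpow_speedSqFst hs hγ (-1))
  exact analyticAt_clm_apply h2 (analyticAt_clm_apply h1 ((taylorL2 hs).analyticAt γ))

theorem analyticAt_normalL2 : AnalyticAt ℝ (normalL2 hs) γ :=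
  analyticAt_const.sub (analyticAt_clm_comp
    (analyticAt_clm_const ((smulE n).holderL offVol 2 ∞ 2) (analyticAt_tangentCoeff hs hγ))
    analyticAt_const)

theorem analyticAt_weightedNormalSq {w : Hs s n → OffDiag →ᵇ ℝ} (hw : AnalyticAt ℝ w γ) :
    AnalyticAt ℝ (fun γ => weightedNormalSq hs (w γ) γ) γ := by
  have h1 : AnalyticAt ℝ (fun γ => normalL2 hs γ γ) γ :=
    analyticAt_clm_apply (analyticAt_normalL2 hs hγ) analyticAt_id
  have h2 : AnalyticAt ℝ (normalSq hs) γ :=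
    analyticAt_clm_apply (analyticAt_clm_const ((innerE n).holderL offVol 2 2 1) h1) h1
  have h3 : AnalyticAt ℝ (fun γ => (ContinuousLinearMap.mul ℝ ℝ).holderL offVol ∞ 1 1
      (toLinf (w γ))) γ :=
    analyticAt_clm_const ((ContinuousLinearMap.mul ℝ ℝ).holderL offVol ∞ 1 1 ∘L toLinf) hw
  exact analyticAt_clm_apply h3 h2

theorem analyticAt_metricForm : AnalyticAt ℝ (metricForm hs) γ := by
  have hw := analyticAt_density hs hγ
  refine ((((analyticAt_weightedForm ?_ _ _).add (analyticAt_weightedForm ?_ _ _)).add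
    (analyticAt_weightedL2Form hw (analyticAt_normalL2 hs hγ))).add
    (analyticAt_weightedForm ?_ _ _)).add
    ((analyticAt_weightedForm ?_ _ _).add (analyticAt_weightedForm ?_ _ _))
  · exact analyticAt_clm_const toL1 (analyticAt_bcfRpow_speedSqFst hs hγ _)
  · exact analyticAt_clm_const toL1 (analyticAt_bcfRpow_speedSqFst hs hγ _)
  · exact analyticAt_weightedNormalSq hs hγ (hw.mul (analyticAt_bcfRpow_chordSq hs hγ _))
  · exact analyticAt_weightedNormalSq hs hγ (hw.mul (analyticAt_bcfRpow_speedSqFst hs hγ _))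
  · exact analyticAt_weightedNormalSq hs hγ (hw.mul (analyticAt_bcfRpow_speedSqSnd hs hγ _))

end Analytic

end Hs

/-! ### Comparison with the defining integrals -/

/-- Double integrals do not see the diagonal. -/
theorem integral_offDiag {f : Circ × Circ → ℝ} {g : OffDiag → ℝ} (h : ∀ p : OffDiag, f p.1 = g p)
    (hg : Integrable g offVol) : Integrable f ∧ ∫ p, g p ∂offVol = ∫ p, f p := by
  have e : g = f ∘ Subtype.val := funext fun p => (h p).symm
  subst e
  exact ⟨(measurePreserving_offDiag.integrable_comp_emb measurableEmbedding_offDiag).1 hg,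
    measurePreserving_offDiag.integral_comp measurableEmbedding_offDiag f⟩

theorem integral_offDiag_fst {f : Circ → ℝ} {g : OffDiag → ℝ} (h : ∀ p : OffDiag, f p.1.1 = g p)
    (hg : Integrable g offVol) : ∫ p, g p ∂offVol = ∫ x, f x := by
  rw [(integral_offDiag (f := fun p => f p.1) h hg).2, Measure.volume_eq_prod, integral_fun_fst]
  simp

namespace Hs

variable (hs : 3 / 2 < s) {γ : Hs s n} (hγ : γ ∈ embeddings s n)

include hγ

theorem bcfRpow_speedSqFst_apply (a : ℝ) (p : OffDiag) :
    bcfRpow a (speedSqFst hs γ) p = (‖circDeriv γ.toFun p.1.1‖ ^ 2) ^ a := by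
  rw [bcfRpow_apply (uniformlyPos_of_mem_embeddings hs hγ).1, speedSqFst, bcfNormSq_apply,
    derivFst_apply]

theorem bcfRpow_speedSqSnd_apply (a : ℝ) (p : OffDiag) :
    bcfRpow a (speedSqSnd hs γ) p = (‖circDeriv γ.toFun p.1.2‖ ^ 2) ^ a := by
  rw [bcfRpow_apply (uniformlyPos_of_mem_embeddings hs hγ).2.1, speedSqSnd, bcfNormSq_apply,
    derivSnd_apply]

theorem bcfRpow_chordSq_apply (a : ℝ) (p : OffDiag) :
    bcfRpow a (chordSq hs γ) p =
      (‖‖p.1.2 - p.1.1‖⁻¹ • (γ p.1.2 - γ p.1.1)‖ ^ 2) ^ a := by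
  rw [bcfRpow_apply (uniformlyPos_of_mem_embeddings hs hγ).2.2, chordSq, bcfNormSq_apply,
    diffQuot_apply]

theorem density_apply (p : OffDiag) :
    density hs γ p = opFactor s γ.toFun p.1 ^ 2 * weight γ.toFun p.1 := by
  rw [opFactor_sq_mul_weight p.2 (fun h => p.2 (hγ.1 h)), density]
  simp only [BoundedContinuousFunction.mul_apply, bcfRpow_speedSqFst_apply hs hγ,
    bcfRpow_speedSqSnd_apply hs hγ, bcfRpow_chordSq_apply hs hγ]

theorem coeFn_normalL2 (h : Hs s n) :
    normalL2 hs γ h =ᵐ[offVol] fun p => normalQuot s γ.toFun h.toFun p.1 := by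
  let I : Lp ℝ 2 offVol := (innerE n).holder 2 (toLinf (derivFst hs γ)) (taylorL2 hs γ)
  have h1 : tangentCoeff hs γ =ᵐ[offVol] fun p => _ :=
    (ContinuousLinearMap.mul ℝ ℝ).coeFn_holder (r := 2) (toLinf (bcfRpow (-1) (speedSqFst hs γ))) I
  have h2 : I =ᵐ[offVol] fun p => _ := (innerE n).coeFn_holder (r := 2) _ _
  let T : Lp (E n) 2 offVol := (smulE n).holder 2 (tangentCoeff hs γ) (toLinf (derivFst hs h))
  have h3 : T =ᵐ[offVol] fun p => _ := (smulE n).coeFn_holder (r := 2) _ _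
  have h4 : normalL2 hs γ h =ᵐ[offVol] _ := Lp.coeFn_sub (taylorL2 hs h) T
  filter_upwards [h1, h2, h3, h4, coeFn_taylorL2 hs h, coeFn_taylorL2 hs γ,
    BoundedContinuousFunction.coeFn_toLp ∞ offVol ℝ (derivFst hs γ),
    BoundedContinuousFunction.coeFn_toLp ∞ offVol ℝ (derivFst hs h),
    BoundedContinuousFunction.coeFn_toLp ∞ offVol ℝ (bcfRpow (-1) (speedSqFst hs γ))]
    with p h1 h2 h3 h4 h5 h6 h7 h8 h9
  rw [h4, Pi.sub_apply, h3, h1, h2, h5, h6, h7, h8, h9, bcfRpow_speedSqFst_apply hs hγ,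
    Real.rpow_neg_one]
  rfl

theorem coeFn_weightedNormalSq (w : OffDiag →ᵇ ℝ) :
    weightedNormalSq hs w γ =ᵐ[offVol]
      fun p => w p * ‖normalQuot s γ.toFun γ.toFun p.1‖ ^ 2 := by
  have h1 : weightedNormalSq hs w γ =ᵐ[offVol] fun p => _ :=
    (ContinuousLinearMap.mul ℝ ℝ).coeFn_holder (r := 1) (toLinf w) (normalSq hs γ)
  have h2 : normalSq hs γ =ᵐ[offVol] fun p => _ :=
    (innerE n).coeFn_holder (r := 1) (normalL2 hs γ γ) (normalL2 hs γ γ)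
  filter_upwards [h1, h2, coeFn_normalL2 hs hγ γ,
    BoundedContinuousFunction.coeFn_toLp ∞ offVol ℝ w] with p h1 h2 h3 h4
  rw [h1, h2, h3, h4, innerE_apply, real_inner_self_eq_norm_sq]
  rfl

theorem op_eq (h : Hs s n) (p : OffDiag) : op s γ.toFun h.toFun p.1 =
    opFactor s γ.toFun p.1 • normalQuot s γ.toFun h.toFun p.1 :=
  op_eq_smul_normalQuot p.2 (hγ.2 _)

theorem norm_op_sq (p : OffDiag) : ‖op s γ.toFun γ.toFun p.1‖ ^ 2 * weight γ.toFun p.1 =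
    density hs γ p * ‖normalQuot s γ.toFun γ.toFun p.1‖ ^ 2 := by
  rw [op_eq hγ, density_apply hs hγ, norm_smul, mul_pow, Real.norm_eq_abs, sq_abs]
  ring

theorem l2Integrand_eq (h k : Hs s n) (p : OffDiag) :
    l2Integrand γ.toFun h.toFun k.toFun p.1.1 = bcfRpow (1 / 2) (speedSqFst hs γ) p *
      inner ℝ (evalFst hs h p) (evalFst hs k p) := by
  rw [l2Integrand, bcfRpow_speedSqFst_apply hs hγ, ← Real.sqrt_eq_rpow,
    Real.sqrt_sq (norm_nonneg _), mul_comm]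
  rfl

theorem h1Integrand_eq (h k : Hs s n) (p : OffDiag) :
    h1Integrand γ.toFun h.toFun k.toFun p.1.1 = bcfRpow (-(1 / 2)) (speedSqFst hs γ) p *
      inner ℝ (derivFst hs h p) (derivFst hs k p) := by
  have h0 : ‖circDeriv γ.toFun p.1.1‖ ≠ 0 := norm_ne_zero_iff.2 (hγ.2 _)
  rw [h1Integrand, bcfRpow_speedSqFst_apply hs hγ, Real.rpow_neg (by positivity),
    ← Real.sqrt_eq_rpow, Real.sqrt_sq (norm_nonneg _), derivFst_apply, derivFst_apply]
  unfold arcDeriv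
  rw [real_inner_smul_left, real_inner_smul_right]
  field_simp

theorem b1Integrand_eq (h k : Hs s n) (p : OffDiag) :
    b1Integrand s γ.toFun h.toFun k.toFun p.1 = density hs γ p *
      inner ℝ (normalQuot s γ.toFun h.toFun p.1) (normalQuot s γ.toFun k.toFun p.1) := by
  rw [b1Integrand, op_eq hγ, op_eq hγ, density_apply hs hγ, real_inner_smul_left,
    real_inner_smul_right]
  ring

theorem b2Integrand_eq (h k : Hs s n) (p : OffDiag) :
    b2Integrand s γ.toFun h.toFun k.toFun p.1 =
      ((density hs γ * bcfRpow (-1) (chordSq hs γ)) p *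
        ‖normalQuot s γ.toFun γ.toFun p.1‖ ^ 2) *
      inner ℝ (diffQuot hs h p) (diffQuot hs k p) := by
  have h0 : ‖γ p.1.2 - γ p.1.1‖ ≠ 0 :=
    norm_ne_zero_iff.2 (sub_ne_zero.2 fun h => p.2 (hγ.1 h).symm)
  have h1 := p.norm_pos.ne'
  rw [b2Integrand, mul_right_comm, norm_op_sq hs hγ, BoundedContinuousFunction.mul_apply,
    bcfRpow_chordSq_apply hs hγ, Real.rpow_neg_one, diffQuot_apply, diffQuot_apply,
    real_inner_smul_left, real_inner_smul_right, norm_smul, norm_inv, norm_norm]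
  field_simp

theorem b3Integrand_eq (h k : Hs s n) (p : OffDiag) :
    b3Integrand s γ.toFun h.toFun k.toFun p.1 =
      ((density hs γ * bcfRpow (-1) (speedSqFst hs γ)) p *
        ‖normalQuot s γ.toFun γ.toFun p.1‖ ^ 2) * inner ℝ (derivFst hs h p) (derivFst hs k p) +
      ((density hs γ * bcfRpow (-1) (speedSqSnd hs γ)) p *
        ‖normalQuot s γ.toFun γ.toFun p.1‖ ^ 2) * inner ℝ (derivSnd hs h p) (derivSnd hs k p) := by
  rw [b3Integrand, mul_right_comm, norm_op_sq hs hγ, BoundedContinuousFunction.mul_apply,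
    BoundedContinuousFunction.mul_apply,
    bcfRpow_speedSqFst_apply hs hγ, bcfRpow_speedSqSnd_apply hs hγ, Real.rpow_neg_one,
    Real.rpow_neg_one, derivFst_apply, derivFst_apply, derivSnd_apply, derivSnd_apply]
  unfold arcDeriv
  simp only [real_inner_smul_left, real_inner_smul_right]
  ring

omit hγ in
include hs in
theorem continuous_l2Integrand (γ h k : Hs s n) :
    Continuous (l2Integrand γ.toFun h.toFun k.toFun) := by
  have h1 := h.continuous
  have h2 := k.continuous
  have h3 := γ.continuous_circDeriv hs
  unfold l2Integrand
  fun_prop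

include hs in
theorem continuous_h1Integrand (h k : Hs s n) :
    Continuous (h1Integrand γ.toFun h.toFun k.toFun) := by
  have h1 := h.continuous_circDeriv hs
  have h2 := k.continuous_circDeriv hs
  have h3 := γ.continuous_circDeriv hs
  have h4 : Continuous fun x => ‖circDeriv γ.toFun x‖⁻¹ :=
    h3.norm.inv₀ fun x => norm_ne_zero_iff.2 (hγ.2 x)
  unfold h1Integrand arcDeriv
  fun_prop

theorem metricIntegrable_and_metricForm_eq (h k : Hs s n) :
    MetricIntegrable s γ.toFun h.toFun k.toFun ∧
      metricForm hs γ h k = metric s γ.toFun h.toFun k.toFun := by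
  have hcont : ∀ {f : Circ → ℝ}, Continuous f → Integrable f := fun hf =>
    hf.integrable_of_hasCompactSupport (HasCompactSupport.of_compactSpace _)
  obtain ⟨i1, e1⟩ := weightedForm_integrand _ (evalFst hs) (evalFst hs) h k
    (BoundedContinuousFunction.coeFn_toLp 1 offVol ℝ (bcfRpow (1 / 2) (speedSqFst hs γ)))
  obtain ⟨i2, e2⟩ := weightedForm_integrand _ (derivFst hs) (derivFst hs) h k
    (BoundedContinuousFunction.coeFn_toLp 1 offVol ℝ (bcfRpow (-(1 / 2)) (speedSqFst hs γ)))
  obtain ⟨i3, e3⟩ := weightedL2Form_integrand (density hs γ) (normalL2 hs γ) h k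
    (coeFn_normalL2 hs hγ h) (coeFn_normalL2 hs hγ k)
  obtain ⟨i4, e4⟩ := weightedForm_integrand _ (diffQuot hs) (diffQuot hs) h k
    (coeFn_weightedNormalSq hs hγ (density hs γ * bcfRpow (-1) (chordSq hs γ)))
  obtain ⟨i5, e5⟩ := weightedForm_integrand _ (derivFst hs) (derivFst hs) h k
    (coeFn_weightedNormalSq hs hγ (density hs γ * bcfRpow (-1) (speedSqFst hs γ)))
  obtain ⟨i6, e6⟩ := weightedForm_integrand _ (derivSnd hs) (derivSnd hs) h k
    (coeFn_weightedNormalSq hs hγ (density hs γ * bcfRpow (-1) (speedSqSnd hs γ)))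
  have t1 := integral_offDiag_fst (l2Integrand_eq hs hγ h k) i1
  have t2 := integral_offDiag_fst (h1Integrand_eq hs hγ h k) i2
  obtain ⟨j3, t3⟩ := integral_offDiag (b1Integrand_eq hs hγ h k) i3
  obtain ⟨j4, t4⟩ := integral_offDiag (b2Integrand_eq hs hγ h k) i4
  obtain ⟨j5, t5⟩ := integral_offDiag (b3Integrand_eq hs hγ h k) (i5.add i6)
  refine ⟨⟨hcont (continuous_l2Integrand hs γ h k), hcont (continuous_h1Integrand hs hγ h k),
    j3, j4, j5⟩, ?_⟩
  rw [integral_add i5 i6] at t5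
  rw [metric, ← t1, ← t2, ← t3, ← t4, ← t5]
  exact congrArg₂ (· + ·) (congrArg₂ (· + ·) (congrArg₂ (· + ·) (congrArg₂ (· + ·) e1 e2) e3) e4)
    (congrArg₂ (· + ·) e5 e6)

omit hγ in
theorem metric_comm (γ h k : Circ → E n) : metric s γ h k = metric s γ k h := by
  unfold metric l2Integrand h1Integrand b1Integrand b2Integrand b3Integrand
  simp only [real_inner_comm]

include hs in
/-- All terms of the metric are nonnegative on the diagonal, and the first of them is positive. -/
theorem metric_pos {h : Hs s n} (hh : h ≠ 0) : 0 < metric s γ.toFun h.toFun h.toFun := by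
  have hw : ∀ p, 0 ≤ weight γ.toFun p := fun p => by unfold weight; positivity
  have h1 : 0 < ∫ x, l2Integrand γ.toFun h.toFun h.toFun x := by
    have hne : ∃ x, h x ≠ 0 := by
      by_contra! hall
      exact hh (toFun_injective (funext hall))
    obtain ⟨x, hx⟩ := hne
    refine (continuous_l2Integrand hs γ h h).integral_pos_of_hasCompactSupport_nonneg_nonzero
      (HasCompactSupport.of_compactSpace _) (fun y => ?_) (x := x) ?_
    · exact mul_nonneg real_inner_self_nonneg (norm_nonneg _)
    · exact mul_ne_zero (inner_self_ne_zero.2 hx) (norm_ne_zero_iff.2 (hγ.2 x))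
  have h2 : 0 ≤ ∫ x, h1Integrand γ.toFun h.toFun h.toFun x := integral_nonneg fun x =>
    mul_nonneg real_inner_self_nonneg (norm_nonneg _)
  have h3 : 0 ≤ ∫ p, b1Integrand s γ.toFun h.toFun h.toFun p := integral_nonneg fun p =>
    mul_nonneg real_inner_self_nonneg (hw p)
  have h4 : 0 ≤ ∫ p, b2Integrand s γ.toFun h.toFun h.toFun p := integral_nonneg fun p =>
    mul_nonneg (mul_nonneg (sq_nonneg _) (div_nonneg real_inner_self_nonneg (sq_nonneg _))) (hw p)
  have h5 : 0 ≤ ∫ p, b3Integrand s γ.toFun h.toFun h.toFun p := integral_nonneg fun p =>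
    mul_nonneg (mul_nonneg (sq_nonneg _)
      (add_nonneg real_inner_self_nonneg real_inner_self_nonneg)) (hw p)
  unfold metric
  linarith

end Hs

end KnotMetric

end

theorem mainTheorem7 (n : ℕ) (s : ℝ) (hs : s ∈ Set.Ioo (3 / 2 : ℝ) 2) :
    IsOpen (KnotMetric.embeddings s n) ∧
    (∀ γ ∈ KnotMetric.embeddings s n, ∀ h k : KnotMetric.Hs s n,
      KnotMetric.MetricIntegrable s γ.toFun h.toFun k.toFun) ∧
    ∃ G : KnotMetric.Hs s n → KnotMetric.Hs s n →L[ℝ] KnotMetric.Hs s n →L[ℝ] ℝ,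
      (∀ γ ∈ KnotMetric.embeddings s n,
        (∀ h k : KnotMetric.Hs s n, G γ h k = KnotMetric.metric s γ.toFun h.toFun k.toFun) ∧
        (∀ h k : KnotMetric.Hs s n, G γ h k = G γ k h) ∧
        (∀ h : KnotMetric.Hs s n, h ≠ 0 → 0 < G γ h h)) ∧
      AnalyticOnNhd ℝ G (KnotMetric.embeddings s n) := by
  have hs' := hs.1
  refine ⟨KnotMetric.isOpen_embeddings hs', fun γ hγ h k =>
    (KnotMetric.Hs.metricIntegrable_and_metricForm_eq hs' hγ h k).1,
    KnotMetric.Hs.metricForm hs', fun γ hγ => ?_,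
    fun γ hγ => KnotMetric.Hs.analyticAt_metricForm hs' hγ⟩
  have e := fun h k => (KnotMetric.Hs.metricIntegrable_and_metricForm_eq hs' hγ h k).2
  refine ⟨e, fun h k => ?_, fun h hh => ?_⟩
  · rw [e, e, KnotMetric.Hs.metric_comm]
  · rw [e]
    exact KnotMetric.Hs.metric_pos hs' hγ hh
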